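/- **Setting.** Let $\Omega\subset\mathbb R^3$ be an arbitrary open set, bounded or not. $L^2$, $L^\infty$ and "a.e." refer to Lebesgue measure on $\Omega$, $\langle\cdot,\cdot\rangle$ is the scalar product of $L^2(\Omega)$ (or of $L^2(\Omega;\mathbb R^3)$), and $H^1_0(\Omega)$ is the closure of $C_c^\infty(\Omega)$ in the norm $|u|_{H^1}=(|u|_{L^2}^2+|\nabla u|_{L^2}^2)^{1/2}$. *Linear part.* Let $a_0,a_1>0$, let $a_{ij}=a_{ji}\in L^\infty(\Omega)$ ($1\le i,j\le 3$) satisfy $a_0|\xi|^2\le\sum_{i,j}a_{ij}(x)\xi_i\xi_j\le a_1|\xi|^2$ for all $\xi\in\mathbb R^3$ and a.e. $x\in\Omega$, and put $A(x)=(a_{ij}(x))_{i,j}$. Let $\beta\colon\Omega\to\mathbb R$ be measurable and such that (i) for every $\delta>0$ there is $C_\delta\ge0$ with $\int_\Omega|\beta|u^2\,dx\le\delta|u|_{H^1}^2+C_\delta|u|_{L^2}^2$ for all $u\in H^1_0(\Omega)$; (ii) $\inf\{\langle A\nabla u,\nabla u\rangle+\langle\beta u,u\rangle : u\in H^1_0(\Omega),\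 |u|_{L^2}=1\}>0$. *Nonlinearity.* Let $f\colon\Omega\times\mathbb R\to\mathbb R$ be such that $f(\cdot,u)$ is Lebesgue measurable for every $u\in\mathbb R$, $f(\cdot,0)\in L^2(\Omega)$, $f(x,\cdot)\in C^2(\mathbb R)$ for a.e. $x$, $\partial_uf(\cdot,0)\in L^\infty(\Omega)$, and $|\partial_{uu}f(x,u)|\le\overline C(1+|u|)$ for some constant $\overline C\ge0$, a.e. $x\in\Omega$ and all $u\in\mathbb R$. Let $\overline\mu>0$ and $c\in L^2(\Omega)$ be such that, with $F(x,u)=\int_0^uf(x,s)\,ds$, one has $f(x,u)u-\overline\mu F(x,u)\le c(x)$ and $F(x,u)\le c(x)$ for a.e. $x\in\Omega$ and all $u\in\mathbb R$. Write $\hat f(u)(x)=f(x,u(x))$; this maps $H^1_0(\Omega)$ into $L^2(\Omega)$. *Spaces.* $H_0=L^2(\Omega)$; $H_1=H^1_0(\Omega)$ with the scalar product $\langle u,v\rangle_{H_1}=\langle A\nabla u,\nabla v\rangle+\langle\beta u,v\rangle$, whose norm is equivalent to $|\cdot|_{H^1}$; and $H_{-1}$ is the dual space of $H_1$ with the dual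 norm $|w|_{H_{-1}}=\sup\{|w(\zeta)| : \zeta\in H_1,\ |\zeta|_{H_1}\le1\}$. A function $v\in L^2(\Omega)$ is regarded as the element $\zeta\mapsto\langle v,\zeta\rangle$ of $H_{-1}$. *Semiflow.* For $\varepsilon>0$ let $\mathbf B_\varepsilon$ be the operator in $H_1\times H_0$ whose domain is the set of all $(u,v)\in H^1_0(\Omega)\times H^1_0(\Omega)$ for which the distribution $\beta u-\sum_{ij}(a_{ij}u_{x_j})_{x_i}$ lies in $L^2(\Omega)$, and $$\mathbf B_\varepsilon(u,v)=\Bigl(-v,\ \tfrac1\varepsilon v+\tfrac1\varepsilon\bigl(\beta u-\textstyle\sum_{ij}(a_{ij}u_{x_j})_{x_i}\bigr)\Bigr).$$ Let $e^{-\mathbf B_\varepsilon t}$, $t\ge0$, be the $C_0$-semigroup with infinitesimal generator $-\mathbf B_\varepsilon$, and let $\pi_\varepsilon$ be the semiflow on $H_1\times H_0$ given by the mild solutions of $\varepsilon u_{tt}+u_t+\beta(x)u-\sum_{ij}(a_{ij}(x)u_{x_j})_{x_i}=f(x,u)$ with $u=0$ on $\partial\Omega$. A *full solution* of $\pi_\varepsilon$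 is thus a continuous map $z=(u,v)\colon\mathbb R\to H_1\times H_0$ with $$z(t)=e^{-\mathbf B_\varepsilon(t-t_0)}z(t_0)+\int_{t_0}^te^{-\mathbf B_\varepsilon(t-s)}\bigl(0,\tfrac1\varepsilon\hat f(u(s))\bigr)\,ds\qquad\text{for all } t_0\le t.$$ **Proposition 3.6.** Let $\varepsilon_0>0$. For every $r\ge0$ there is a constant $C(r,\varepsilon_0)\in[0,\infty[$ (which may also depend on the fixed data $\Omega,a_{ij},\beta,f$, but not on $\varepsilon$ or on the solution) such that, whenever $0<\varepsilon\le\varepsilon_0$ and $z=(u,v)\colon\mathbb R\to H_1\times H_0$ is a full solution of $\pi_\varepsilon$ with $$\sup_{t\in\mathbb R}\bigl(|u(t)|_{H_1}^2+\varepsilon|v(t)|_{H_0}^2\bigr)\le r,$$ then $v$ is differentiable as a map from $\mathbb R$ into $H_{-1}$ and its derivative $w=\partial(v;H_{-1})$ satisfies $$\sup_{t\in\mathbb R}\bigl(|v(t)|_{H_0}^2+\varepsilon|w(t)|_{H_{-1}}^2\bigr)\le C(r,\varepsilon_0).$$ -/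

import Mathlib

open MeasureTheory Set Filter Topology TopologicalSpace
open scoped Distributions Gradient ENNReal

noncomputable section

namespace DampedWave

/-- The Euclidean space `ℝ³`. -/
abbrev E3 : Type := EuclideanSpace ℝ (Fin 3)

/-- Lebesgue measure on the open set `Ω ⊆ ℝ³`. -/
abbrev vol (Ω : Opens E3) : Measure E3 := (volume : Measure E3).restrict (Ω : Set E3)

/-- `H_0 = L²(Ω)`. -/
abbrev L2 (Ω : Opens E3) : Type := Lp ℝ 2 (vol Ω)

/-- `L²(Ω; ℝ³)`, the space of square integrable vector fields. -/
abbrev L2vec (Ω : Opens E3) : Type := Lp E3 2 (vol Ω)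

/-! ### The Sobolev space `H¹₀(Ω)` -/

/-- The pairs `(φ, ∇φ)` with `φ ∈ C_c^∞(Ω)`, as a linear subspace of `L²(Ω) × L²(Ω; ℝ³)`; the norm
of the Hilbert sum, `(|φ|²_{L²} + |∇φ|²_{L²})^{1/2}`, is the usual `H¹`-norm of `φ`. -/
def testGraph (Ω : Opens E3) : Submodule ℝ (WithLp 2 (L2 Ω × L2vec Ω)) where
  carrier := {p | ∃ φ : 𝓓(Ω, ℝ), p.fst =ᵐ[vol Ω] φ ∧ p.snd =ᵐ[vol Ω] ∇ (φ : E3 → ℝ)}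
  zero_mem' := by
    refine ⟨0, ?_, ?_⟩
    · simpa using Lp.coeFn_zero ℝ 2 (vol Ω)
    · filter_upwards [Lp.coeFn_zero E3 2 (vol Ω)] with x hx
      have h : ((0 : 𝓓(Ω, ℝ)) : E3 → ℝ) = fun _ => (0 : ℝ) := rfl
      rw [h, gradient_fun_const']
      simpa using hx
  add_mem' := by
    rintro p q ⟨φ, h1, h2⟩ ⟨ψ, h3, h4⟩
    refine ⟨φ + ψ, ?_, ?_⟩
    · filter_upwards [Lp.coeFn_add p.fst q.fst, h1, h3] with x hx h1 h3
      simp only [WithLp.add_fst, hx, Pi.add_apply, h1, h3, FunLike.coe_add]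
    · filter_upwards [Lp.coeFn_add p.snd q.snd, h2, h4] with x hx h2 h4
      have hφ : DifferentiableAt ℝ (φ : E3 → ℝ) x :=
        (φ.contDiff.differentiable (by simp)).differentiableAt
      have hψ : DifferentiableAt ℝ (ψ : E3 → ℝ) x :=
        (ψ.contDiff.differentiable (by simp)).differentiableAt
      simp only [WithLp.add_snd, hx, Pi.add_apply, h2, h4, FunLike.coe_add, gradient,
        fderiv_add hφ hψ, map_add]
  smul_mem' := by
    rintro c p ⟨φ, h1, h2⟩
    refine ⟨c • φ, ?_, ?_⟩
    · filter_upwards [Lp.coeFn_smul c p.fst, h1] with x hx h1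
      simp only [WithLp.smul_fst, hx, Pi.smul_apply, h1, FunLike.coe_smul]
    · filter_upwards [Lp.coeFn_smul c p.snd, h2] with x hx h2
      have hφ : DifferentiableAt ℝ (φ : E3 → ℝ) x :=
        (φ.contDiff.differentiable (by simp)).differentiableAt
      simp only [WithLp.smul_snd, hx, Pi.smul_apply, h2, FunLike.coe_smul, gradient,
        fderiv_const_smul hφ, map_smul]

/-- `H¹₀(Ω)`: the closure of `C_c^∞(Ω)` in the `H¹`-norm. A function is stored together with its
weak gradient, so an element is a pair `(u, ∇u)` and `‖(u, ∇u)‖² = |u|²_{L²} + |∇u|²_{L²}`. -/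
abbrev H10 (Ω : Opens E3) : Type := ↥(testGraph Ω).topologicalClosure

/-- The inclusion `H¹₀(Ω) → L²(Ω)`, `(u, ∇u) ↦ u`. -/
def toL2 (Ω : Opens E3) : H10 Ω →L[ℝ] L2 Ω :=
  (WithLp.fstL 2 ℝ (L2 Ω) (L2vec Ω)).comp (testGraph Ω).topologicalClosure.subtypeL

/-- The weak gradient `H¹₀(Ω) → L²(Ω; ℝ³)`, `(u, ∇u) ↦ ∇u`. -/
def grad (Ω : Opens E3) : H10 Ω →L[ℝ] L2vec Ω :=
  (WithLp.sndL 2 ℝ (L2 Ω) (L2vec Ω)).comp (testGraph Ω).topologicalClosure.subtypeL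

/-! ### The bilinear form, the spaces `H_1` and `H_{-1}` -/

/-- `⟨A∇u, ∇v⟩ + ⟨βu, v⟩` for functions `u`, `v` on `Ω` with gradients `gu`, `gv`. -/
def formFun (Ω : Opens E3) (a : Fin 3 → Fin 3 → E3 → ℝ) (β : E3 → ℝ)
    (u : E3 → ℝ) (gu : E3 → E3) (v : E3 → ℝ) (gv : E3 → E3) : ℝ :=
  (∫ x, ∑ i, ∑ j, a i j x * gu x j * gv x i ∂vol Ω) + ∫ x, β x * u x * v x ∂vol Ω

/-- The scalar product `⟨u, v⟩_{H_1} = ⟨A∇u, ∇v⟩ + ⟨βu, v⟩` on `H_1 = H¹₀(Ω)`. -/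
def h1Inner {Ω : Opens E3} (a : Fin 3 → Fin 3 → E3 → ℝ) (β : E3 → ℝ) (u v : H10 Ω) : ℝ :=
  formFun Ω a β (toL2 Ω u) (grad Ω u) (toL2 Ω v) (grad Ω v)

/-- `H_{-1} = H^{-1}(Ω)`, the dual of `H¹₀(Ω)`. Its topology is that of the operator norm; the norm
used in estimates is `hNegNorm`, the (equivalent) dual norm of the norm of `H_1`. -/
abbrev HNeg (Ω : Opens E3) : Type := StrongDual ℝ (H10 Ω)

/-- The norm of `H_{-1}`: `|w|_{H_{-1}} = sup {|w(ζ)| : ζ ∈ H_1, |ζ|_{H_1} ≤ 1}`.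
Under `LinearAssumption` below the set is bounded, because `|·|_{H_1}` is then equivalent to the
`H¹`-norm. -/
def hNegNorm {Ω : Opens E3} (a : Fin 3 → Fin 3 → E3 → ℝ) (β : E3 → ℝ) (w : HNeg Ω) : ℝ :=
  sSup ((fun ζ : H10 Ω => |w ζ|) '' {ζ | h1Inner a β ζ ζ ≤ 1})

/-- The inclusion `L²(Ω) → H_{-1}`, `v ↦ (ζ ↦ ⟨v, ζ⟩)`. -/
def toHNeg (Ω : Opens E3) (v : L2 Ω) : HNeg Ω := (innerSL ℝ v).comp (toL2 Ω)

/-! ### Assumptions on the coefficients and on the nonlinearity -/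

/-- The assumption on the linear part. In `coercive`, the conclusion says that the infimum of
`⟨A∇u, ∇u⟩ + ⟨βu, u⟩` over all `u ∈ H¹₀(Ω)` with `|u|_{L²} = 1` is positive. -/
structure LinearAssumption (Ω : Opens E3) (a₀ a₁ : ℝ) (a : Fin 3 → Fin 3 → E3 → ℝ)
    (β : E3 → ℝ) : Prop where
  a₀_pos : 0 < a₀
  a₁_pos : 0 < a₁
  memLinfty : ∀ i j, MemLp (a i j) ∞ (vol Ω)
  symm : ∀ i j, a i j =ᵐ[vol Ω] a j i
  elliptic : ∀ᵐ x ∂vol Ω, ∀ ξ : E3,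
    a₀ * ‖ξ‖ ^ 2 ≤ ∑ i, ∑ j, a i j x * ξ i * ξ j ∧
      ∑ i, ∑ j, a i j x * ξ i * ξ j ≤ a₁ * ‖ξ‖ ^ 2
  β_meas : AEMeasurable β (vol Ω)
  β_bound : ∀ δ : ℝ, 0 < δ → ∃ C : ℝ, 0 ≤ C ∧ ∀ u : H10 Ω,
    ∫⁻ x, ENNReal.ofReal (|β x| * (toL2 Ω u x) ^ 2) ∂vol Ω
      ≤ ENNReal.ofReal (δ * ‖u‖ ^ 2 + C * ‖toL2 Ω u‖ ^ 2)
  coercive : ∃ l : ℝ, 0 < l ∧ ∀ u : H10 Ω, ‖toL2 Ω u‖ = 1 → l ≤ h1Inner a β u u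

open Classical in
/-- `F(x, u) = ∫_0^u f(x, s) ds` if `f(x, ·)` is continuous, and `F(x, u) = 0` otherwise. -/
def primitive (f : E3 → ℝ → ℝ) (x : E3) (u : ℝ) : ℝ :=
  if Continuous (f x) then ∫ s in (0 : ℝ)..u, f x s else 0

/-- The assumption on the nonlinearity `f`. -/
structure NonlinearAssumption (Ω : Opens E3) (f : E3 → ℝ → ℝ) (μ : ℝ) (c : E3 → ℝ) :
    Prop where
  meas : ∀ u : ℝ, AEMeasurable (fun x => f x u) (vol Ω)
  memL2 : MemLp (fun x => f x 0) 2 (vol Ω)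
  contDiff : ∀ᵐ x ∂vol Ω, ContDiff ℝ 2 (f x)
  deriv_memLinfty : MemLp (fun x => deriv (f x) 0) ∞ (vol Ω)
  growth : ∃ C : ℝ, 0 ≤ C ∧ ∀ᵐ x ∂vol Ω, ∀ u : ℝ, |iteratedDeriv 2 (f x) u| ≤ C * (1 + |u|)
  μ_pos : 0 < μ
  c_memL2 : MemLp c 2 (vol Ω)
  dissip : ∀ᵐ x ∂vol Ω, ∀ u : ℝ, f x u * u - μ * primitive f x u ≤ c x
  primitive_le : ∀ᵐ x ∂vol Ω, ∀ u : ℝ, primitive f x u ≤ c x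

/-! ### The semiflow `π_ε` -/

/-- The phase space `H¹₀(Ω) × L²(Ω) = H_1 × H_0`. -/
abbrev Phase (Ω : Opens E3) : Type := H10 Ω × L2 Ω

/-- `βu - ∑_{ij} (a_{ij} u_{x_j})_{x_i} = h` in the sense of distributions on `Ω`. -/
def IsEllipticOp {Ω : Opens E3} (a : Fin 3 → Fin 3 → E3 → ℝ) (β : E3 → ℝ)
    (u : H10 Ω) (h : L2 Ω) : Prop :=
  ∀ φ : 𝓓(Ω, ℝ), formFun Ω a β (toL2 Ω u) (grad Ω u) φ (∇ (φ : E3 → ℝ)) = ∫ x, h x * φ x ∂vol Ω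

/-- `B_ε z = y`. That is, `z = (u, v)` lies in `D(B_ε)`: `v ∈ H¹₀(Ω)` and
`h = βu - ∑_{ij} (a_{ij} u_{x_j})_{x_i}` lies in `L²(Ω)`; and
`y = (-v, (1/ε) v + (1/ε) h)`. -/
def IsB {Ω : Opens E3} (a : Fin 3 → Fin 3 → E3 → ℝ) (β : E3 → ℝ) (ε : ℝ) (z y : Phase Ω) : Prop :=
  ∃ (v : H10 Ω) (h : L2 Ω), toL2 Ω v = z.2 ∧ IsEllipticOp a β z.1 h ∧
    y = (-v, (1 / ε) • z.2 + (1 / ε) • h)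

/-- `(T t)_{t ≥ 0}` is a strongly continuous semigroup of bounded linear operators on `Z`
(the values at negative times are irrelevant). -/
structure IsC0Semigroup {Z : Type*} [NormedAddCommGroup Z] [NormedSpace ℝ Z]
    (T : ℝ → Z →L[ℝ] Z) : Prop where
  zero : T 0 = ContinuousLinearMap.id ℝ Z
  add : ∀ s t : ℝ, 0 ≤ s → 0 ≤ t → T (s + t) = (T s).comp (T t)
  cont : ∀ z : Z, ContinuousOn (fun t => T t z) (Ici 0)

/-- `T t = e^{-B_ε t}` for `t ≥ 0`: `T` is the strongly continuous semigroup whose infinitesimal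
generator, with its exact domain, is `-B_ε`. -/
def IsSemigroupOfB {Ω : Opens E3} (a : Fin 3 → Fin 3 → E3 → ℝ) (β : E3 → ℝ) (ε : ℝ)
    (T : ℝ → Phase Ω →L[ℝ] Phase Ω) : Prop :=
  IsC0Semigroup T ∧ ∀ z y : Phase Ω,
    Tendsto (fun t : ℝ => t⁻¹ • (T t z - z)) (𝓝[>] 0) (𝓝 (-y)) ↔ IsB a β ε z y

open Classical in
/-- The Nemitski operator `f̂(u)(x) = f(x, u(x))`, from `H¹₀(Ω)` to `L²(Ω)` (with the value `0` if
`f̂(u)` should fail to be in `L²(Ω)`). -/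
def nemitski {Ω : Opens E3} (f : E3 → ℝ → ℝ) (u : H10 Ω) : L2 Ω :=
  if h : MemLp (fun x => f x (toL2 Ω u x)) 2 (vol Ω) then h.toLp else 0

/-- `z : ℝ → H_1 × H_0` is a full solution of `π_ε`: it is continuous and, for all `t₀ ≤ t`,
`z(t) = e^{-B_ε (t - t₀)} z(t₀) + ∫_{t₀}^t e^{-B_ε (t - s)} (0, (1/ε) f̂(u(s))) ds`. -/
def IsFullSolution {Ω : Opens E3} (a : Fin 3 → Fin 3 → E3 → ℝ) (β : E3 → ℝ) (f : E3 → ℝ → ℝ)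
    (ε : ℝ) (z : ℝ → Phase Ω) : Prop :=
  ∃ T : ℝ → Phase Ω →L[ℝ] Phase Ω, IsSemigroupOfB a β ε T ∧ Continuous z ∧
    ∀ t₀ t : ℝ, t₀ ≤ t →
      z t = T (t - t₀) (z t₀) +
        ∫ s in t₀..t, T (t - s) ((0 : H10 Ω), (1 / ε) • nemitski f (z s).1)

end DampedWave

end

/-!
A full solution `z = (u, v)` satisfies `∂ₜu = v` in `L²(Ω)` and `ε ∂ₜv = f̂(u) - v - 𝐀u` in
`H_{-1}`, where `𝐀 : H_1 → H_{-1}` is the isometry given by the scalar product of `H_1`: by the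
variation of constants formula, `∫ z` lies in the domain of `𝐁_ε`, so that the equation holds after
integration in time (`IsC0Semigroup.tendsto_of_mild`, `IsFullSolution.isWeakSolution`). Hence
`w = ∂ₜv` exists in `H_{-1}`. Its bound combines two energy estimates.

* The energy `(|u|²_{H_1} + ε|v|²_{L²}) / 2 - ∫ F(x, u)` decreases at the rate `|v|²_{L²}`. On the
  given solutions it is bounded in terms of `r` and the data, hence so is `∫ |v|²_{L²} dt` over any
  time interval (`IsWeakSolution.energy_identity`, `NonlinearAssumption.hasDerivAt_potential`,
  `IsFullSolution.integral_norm_sq_le`).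

* `(v, w)` formally solves the linear equation `ε ∂ₜw + w + 𝐀v = ∂ᵤf(·, u) v`. Testing with `w` in
  `H_{-1}`, where `⟨w, 𝐀v⟩_{H_{-1}} = ⟨w, v⟩`, gives
  `∂ₜ(|v|²_{L²} + ε|w|²_{H_{-1}}) + |w|²_{H_{-1}} ≤ |∂ᵤf(·, u) v|²_{H_{-1}} ≤ K |v|²_{L²}`, with `K`
  depending on `r` and the data only. The last inequality holds because `∂ᵤf` grows quadratically
  and `H¹₀(Ω) ⊂ L⁶(Ω)` (`exists_sobolev`, `NonlinearAssumption.exists_inner_nemitski_sub_le`). The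
  estimate is made rigorous with difference quotients of `z`, so that `∂ᵤf` never appears
  (`IsWeakSolution.derivative_energy_le`).

For fixed `ε` the pair `(v, w)` is bounded, so the second estimate makes
`|v|²_{L²} + ε|w|²_{H_{-1}}` integrable near `t = -∞`; it is therefore arbitrarily small at suitable
times in the past. Starting from such times, the second estimate bounds it by `K ∫ |v|²_{L²} dt`,
which the first one controls (`IsWeakSolution.derivative_energy_le_of_bounded`).
-/

noncomputable section

namespace DampedWave

/-! ### Time averages -/

section Average

variable {E : Type*} [NormedAddCommGroup E] [NormedSpace ℝ E]

/-- The time average of `f` over `[t, t + h]`, written as an integral over `[0, 1]` so that it is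
jointly continuous in `(h, t)` up to and including `h = 0`, where its value is `f t`. -/
def timeAverage (f : ℝ → E) (h t : ℝ) : E := ∫ θ in (0 : ℝ)..1, f (t + h * θ)

theorem smul_timeAverage (f : ℝ → E) (h t : ℝ) :
    h • timeAverage f h t = ∫ s in t..t + h, f s := by
  simp [timeAverage, intervalIntegral.smul_integral_comp_add_mul]

theorem continuous_timeAverage {f : ℝ → E} (hf : Continuous f) :
    Continuous fun p : ℝ × ℝ => timeAverage f p.1 p.2 := by
  unfold timeAverage
  apply intervalIntegral.continuous_parametric_intervalIntegral_of_continuous'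
  unfold Function.uncurry
  fun_prop

theorem continuous_timeAverage_left {f : ℝ → E} (hf : Continuous f) (t : ℝ) :
    Continuous fun h => timeAverage f h t :=
  (continuous_timeAverage hf).comp (by fun_prop : Continuous fun h : ℝ => (h, t))

theorem continuous_timeAverage_right {f : ℝ → E} (hf : Continuous f) (h : ℝ) :
    Continuous (timeAverage f h) :=
  (continuous_timeAverage hf).comp (by fun_prop : Continuous fun t : ℝ => (h, t))

theorem timeAverage_zero [CompleteSpace E] (f : ℝ → E) (t : ℝ) : timeAverage f 0 t = f t := by
  simp [timeAverage]

theorem timeAverage_eq_of_hasDerivAt [CompleteSpace E] {f f' : ℝ → E}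
    (hf : ∀ t, HasDerivAt f (f' t) t) (hf' : Continuous f') {h : ℝ} (hh : h ≠ 0) (t : ℝ) :
    timeAverage f' h t = h⁻¹ • (f (t + h) - f t) := by
  rw [eq_inv_smul_iff₀ hh, smul_timeAverage,
    intervalIntegral.integral_eq_sub_of_hasDerivAt (fun x _ => hf x)
      (hf'.intervalIntegrable _ _)]

theorem hasDerivAt_timeAverage [CompleteSpace E] {f : ℝ → E} (hf : Continuous f) {h : ℝ}
    (hh : h ≠ 0) (t : ℝ) :
    HasDerivAt (timeAverage f h) (h⁻¹ • (f (t + h) - f t)) t := by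
  have hF : ∀ t, HasDerivAt (fun t => ∫ s in (0 : ℝ)..t, f s) (f t) t := fun t =>
    hf.integral_hasStrictDerivAt 0 t |>.hasDerivAt
  have h1 : timeAverage f h
      = fun t => h⁻¹ • ((∫ s in (0 : ℝ)..t + h, f s) - ∫ s in (0 : ℝ)..t, f s) :=
    funext fun t => timeAverage_eq_of_hasDerivAt hF hf hh t
  rw [h1]
  exact (((hF (t + h)).comp_add_const t h).sub (hF t)).const_smul h⁻¹

theorem map_timeAverage [CompleteSpace E] {F : Type*} [NormedAddCommGroup F] [NormedSpace ℝ F]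
    [CompleteSpace F] (L : E →L[ℝ] F) {f : ℝ → E} (hf : Continuous f) (h t : ℝ) :
    L (timeAverage f h t) = timeAverage (fun s => L (f s)) h t :=
  (L.intervalIntegral_comp_comm (Continuous.intervalIntegrable (by fun_prop) _ _)).symm

theorem timeAverage_sub {f g : ℝ → E} (hf : Continuous f) (hg : Continuous g) (h t : ℝ) :
    timeAverage (fun s => f s - g s) h t = timeAverage f h t - timeAverage g h t :=
  intervalIntegral.integral_sub (Continuous.intervalIntegrable (by fun_prop) _ _)
    (Continuous.intervalIntegrable (by fun_prop) _ _)

theorem timeAverage_const_smul (c : ℝ) (f : ℝ → E) (h t : ℝ) :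
    timeAverage (fun s => c • f s) h t = c • timeAverage f h t :=
  intervalIntegral.integral_smul _ _

theorem hasDerivAt_of_sub_eq_integral [CompleteSpace E] {f f' : ℝ → E} (hf' : Continuous f')
    (h : ∀ s t, f t - f s = ∫ τ in s..t, f' τ) (t : ℝ) : HasDerivAt f (f' t) t := by
  have h1 : f = fun t => f 0 + ∫ τ in (0 : ℝ)..t, f' τ := funext fun t => by rw [← h 0 t]; abel
  rw [h1]
  exact ((hf'.integral_hasStrictDerivAt 0 t).hasDerivAt).const_add _

end Average

/-! ### Mild solutions -/

section Semigroup

variable {Z : Type*} [NormedAddCommGroup Z] [NormedSpace ℝ Z] [CompleteSpace Z]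
  {T : ℝ → Z →L[ℝ] Z}

/-- A strongly continuous semigroup is jointly continuous; `max` extends it to all times. -/
theorem IsC0Semigroup.continuous_uncurry (hT : IsC0Semigroup T) :
    Continuous fun p : ℝ × Z => T (max p.1 0) p.2 := by
  have hc : ∀ z, Continuous fun t : ℝ => T (max t 0) z := fun z =>
    (hT.cont z).comp_continuous (by fun_prop) fun t => mem_Ici.2 (le_max_right _ _)
  rw [continuous_iff_continuousAt]
  rintro ⟨t, x⟩
  obtain ⟨M, hM⟩ : ∃ M, ∀ s : Icc (t - 1) (t + 1), ‖T (max (s : ℝ) 0)‖ ≤ M := by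
    refine banach_steinhaus fun z => ?_
    obtain ⟨C, hC⟩ := isCompact_Icc.exists_bound_of_continuousOn (hc z).continuousOn
    exact ⟨C, fun s => hC s s.2⟩
  have hlim : Tendsto (fun p : ℝ × Z => M * ‖p.2 - x‖ + ‖T (max p.1 0) x - T (max t 0) x‖)
      (𝓝 (t, x)) (𝓝 0) := by
    have : Continuous fun p : ℝ × Z =>
        M * ‖p.2 - x‖ + ‖T (max p.1 0) x - T (max t 0) x‖ := by
      have := (hc x).comp (continuous_fst (X := ℝ) (Y := Z))
      exact (by fun_prop : Continuous fun p : ℝ × Z => M * ‖p.2 - x‖).add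
        (this.sub continuous_const).norm
    simpa using this.tendsto (t, x)
  rw [ContinuousAt, tendsto_iff_norm_sub_tendsto_zero]
  refine squeeze_zero' (Eventually.of_forall fun _ => norm_nonneg _) ?_ hlim
  have hmem : ∀ᶠ p : ℝ × Z in 𝓝 (t, x), p.1 ∈ Icc (t - 1) (t + 1) :=
    continuous_fst.continuousAt.eventually (Icc_mem_nhds (by simp) (by simp))
  filter_upwards [hmem] with p hp
  calc ‖T (max p.1 0) p.2 - T (max t 0) x‖
      = ‖T (max p.1 0) (p.2 - x) + (T (max p.1 0) x - T (max t 0) x)‖ := by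
        rw [map_sub]; congr 1; abel
    _ ≤ ‖T (max p.1 0) (p.2 - x)‖ + ‖T (max p.1 0) x - T (max t 0) x‖ := norm_add_le _ _
    _ ≤ _ := by
        gcongr
        exact (T (max p.1 0)).le_of_opNorm_le (hM ⟨p.1, hp⟩) _

/-- If `z` is a mild solution of `z' = Az + g`, where `A` generates `T`, then `∫ z` lies in the
domain of `A` and `A ∫ z = z t - z t₀ - ∫ g`: a mild solution solves the equation after
integration in time. -/
theorem IsC0Semigroup.tendsto_of_mild (hT : IsC0Semigroup T) {z g : ℝ → Z} (hz : Continuous z)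
    (hg : Continuous g)
    (hmild : ∀ t₀ t : ℝ, t₀ ≤ t → z t = T (t - t₀) (z t₀) + ∫ s in t₀..t, T (t - s) (g s))
    (t₀ t : ℝ) :
    Tendsto (fun h : ℝ => h⁻¹ • (T h (∫ s in t₀..t, z s) - ∫ s in t₀..t, z s)) (𝓝[>] 0)
      (𝓝 (z t - z t₀ - ∫ s in t₀..t, g s)) := by
  have hTc := hT.continuous_uncurry
  -- `k h s` is the Duhamel term over `[s, s + h]`, divided by `h`
  set k : ℝ → ℝ → Z := fun h s => ∫ θ in (0 : ℝ)..1, T (max (h - h * θ) 0) (g (s + h * θ))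
    with hk
  have hkc : Continuous fun p : ℝ × ℝ => k p.1 p.2 := by
    apply intervalIntegral.continuous_parametric_intervalIntegral_of_continuous'
    exact hTc.comp (g := fun p : ℝ × Z => T (max p.1 0) p.2)
      (f := fun q : (ℝ × ℝ) × ℝ => (q.1.1 - q.1.1 * q.2, g (q.1.2 + q.1.1 * q.2)))
      (by fun_prop)
  have hstep : ∀ h, 0 < h → ∀ s, T h (z s) = z (s + h) - h • k h s := by
    intro h hh s
    have h1 := hmild s (s + h) (by linarith)
    have h2 : h • k h s = ∫ σ in s..s + h, T (s + h - σ) (g σ) := by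
      have := intervalIntegral.smul_integral_comp_add_mul (a := 0) (b := 1)
        (fun σ => T (max (s + h - σ) 0) (g σ)) h s
      simp only [mul_zero, add_zero, mul_one] at this
      have h3 : ∀ θ : ℝ, h - h * θ = s + h - (s + h * θ) := fun θ => by ring
      simp only [hk, h3]
      rw [this]
      refine intervalIntegral.integral_congr fun σ hσ => ?_
      rw [uIcc_of_le (by linarith)] at hσ
      rw [max_eq_left (by linarith [hσ.2])]
    rw [h2, h1, add_sub_cancel_right, add_sub_cancel_left]
  have hev : ∀ h, 0 < h → h⁻¹ • (T h (∫ s in t₀..t, z s) - ∫ s in t₀..t, z s)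
      = timeAverage z h t - timeAverage z h t₀ - ∫ s in t₀..t, k h s := by
    intro h hh
    have hkh : Continuous (k h) := hkc.comp (by fun_prop : Continuous fun s : ℝ => (h, s))
    have hzi : ∀ a b, IntervalIntegrable z volume a b := fun a b => hz.intervalIntegrable _ _
    rw [inv_smul_eq_iff₀ hh.ne', smul_sub, smul_sub, smul_timeAverage, smul_timeAverage,
      ← (T h).intervalIntegral_comp_comm (hzi _ _),
      intervalIntegral.integral_congr (fun s _ => hstep h hh s),
      intervalIntegral.integral_sub
        (Continuous.intervalIntegrable (by fun_prop) _ _)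
        (Continuous.intervalIntegrable (by fun_prop) _ _),
      intervalIntegral.integral_smul, intervalIntegral.integral_comp_add_right]
    have h1 := intervalIntegral.integral_add_adjacent_intervals (hzi t₀ t) (hzi t (t + h))
    have h2 := intervalIntegral.integral_add_adjacent_intervals
      (hzi t₀ (t₀ + h)) (hzi (t₀ + h) (t + h))
    rw [← h2] at h1
    rw [eq_sub_of_add_eq' h1.symm]
    abel
  have hcont : Continuous fun h =>
      timeAverage z h t - timeAverage z h t₀ - ∫ s in t₀..t, k h s := by
    exact ((continuous_timeAverage_left hz t).sub (continuous_timeAverage_left hz t₀)).sub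
      (intervalIntegral.continuous_parametric_intervalIntegral_of_continuous' hkc _ _)
  -- the right-hand side of `hev` is continuous in `h`, and its value at `h = 0` is the limit
  have hlim := (hcont.tendsto 0).mono_left (nhdsWithin_le_nhds (s := Ioi 0))
  have hk0 : ∀ s, k 0 s = g s := fun s => by simp [hk, hT.zero]
  simp only [timeAverage_zero, hk0] at hlim
  refine hlim.congr' ?_
  filter_upwards [self_mem_nhdsWithin] with h hh using (hev h hh).symm

end Semigroup

/-! ### Energy estimates for abstract damped wave equations -/

section Energy

variable {V H : Type*} [NormedAddCommGroup V] [InnerProductSpace ℝ V]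
  [NormedAddCommGroup H] [InnerProductSpace ℝ H]

/-- The map `H → V'`, `v ↦ (ζ ↦ ⟪v, j ζ⟫)` dual to `j : V → H`. -/
def dualIncl (j : V →L[ℝ] H) : H →L[ℝ] StrongDual ℝ V :=
  LinearMap.mkContinuous
    { toFun := fun v => (innerSL ℝ v).comp j
      map_add' := fun v w => by ext ζ; simp
      map_smul' := fun c v => by ext ζ; simp }
    ‖j‖ fun v => by
      rw [mul_comm]
      exact (ContinuousLinearMap.opNorm_comp_le _ _).trans (by simp)

@[simp]
theorem dualIncl_apply (j : V →L[ℝ] H) (v : H) (ζ : V) : dualIncl j v ζ = inner ℝ v (j ζ) := rfl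

/-- The second derivative in time `∂ₜv = ε⁻¹ (g - v - b u)` of a solution of
`ε ∂ₜ²u + ∂ₜu + b u = g`, as an element of `V'`. -/
def accel (j : V →L[ℝ] H) (b : V →L[ℝ] V →L[ℝ] ℝ) (ε : ℝ) (u : ℝ → V) (v g : ℝ → H) (t : ℝ) :
    StrongDual ℝ V :=
  ε⁻¹ • (dualIncl j (g t) - dualIncl j (v t) - b (u t))

/-- `(u, v)` is a weak solution of `ε ∂ₜ²u + ∂ₜu + b u = g` with finite energy: `v = ∂ₜu` in `H`
and the equation holds in `V'`. -/
structure IsWeakSolution (j : V →L[ℝ] H) (b : V →L[ℝ] V →L[ℝ] ℝ) (ε : ℝ) (u : ℝ → V)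
    (v g : ℝ → H) : Prop where
  continuous_u : Continuous u
  continuous_v : Continuous v
  continuous_g : Continuous g
  hasDerivAt_u : ∀ t, HasDerivAt (fun s => j (u s)) (v t) t
  hasDerivAt_v : ∀ t, HasDerivAt (fun s => dualIncl j (v s)) (accel j b ε u v g t) t

namespace IsWeakSolution

variable {j : V →L[ℝ] H} {b : V →L[ℝ] V →L[ℝ] ℝ} {ε : ℝ} {u : ℝ → V} {v g : ℝ → H}

theorem continuous_accel (hz : IsWeakSolution j b ε u v g) :
    Continuous (accel j b ε u v g) := by
  have := hz.continuous_u
  have := hz.continuous_v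
  have := hz.continuous_g
  unfold accel
  fun_prop

/-- It suffices to check the equation after integration in time, where it holds in `H`. -/
theorem of_integral [CompleteSpace V] [CompleteSpace H] (hu : Continuous u) (hv : Continuous v)
    (hg : Continuous g) (h1 : ∀ s t, j (u t) - j (u s) = ∫ τ in s..t, v τ)
    (h2 : ∀ s t, ∃ h, b (∫ τ in s..t, u τ) = dualIncl j h ∧
      v t - v s = ε⁻¹ • ((∫ τ in s..t, g τ) - (∫ τ in s..t, v τ) - h)) :
    IsWeakSolution j b ε u v g := by
  have hac : Continuous (accel j b ε u v g) := by
    unfold accel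
    fun_prop
  refine ⟨hu, hv, hg, hasDerivAt_of_sub_eq_integral hv h1,
    hasDerivAt_of_sub_eq_integral hac fun s t => ?_⟩
  obtain ⟨h, hh, h3⟩ := h2 s t
  simp only [accel]
  rw [← map_sub, h3, map_smul, map_sub, map_sub, ← hh, intervalIntegral.integral_smul,
    intervalIntegral.integral_sub (Continuous.intervalIntegrable (by fun_prop) _ _)
      (Continuous.intervalIntegrable (by fun_prop) _ _),
    intervalIntegral.integral_sub (Continuous.intervalIntegrable (by fun_prop) _ _)
      (Continuous.intervalIntegrable (by fun_prop) _ _),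
    ContinuousLinearMap.intervalIntegral_comp_comm _ (hg.intervalIntegrable _ _),
    ContinuousLinearMap.intervalIntegral_comp_comm _ (hv.intervalIntegrable _ _),
    ContinuousLinearMap.intervalIntegral_comp_comm _ (hu.intervalIntegrable _ _)]

theorem norm_accel_le (hε : 0 < ε) {R M G : ℝ} {t : ℝ} (hR : ‖u t‖ ≤ R) (hM : ‖v t‖ ≤ M)
    (hG : ‖g t‖ ≤ G) :
    ‖accel j b ε u v g t‖ ≤ ε⁻¹ * (‖dualIncl j‖ * G + ‖dualIncl j‖ * M + ‖b‖ * R) := by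
  rw [accel, norm_smul, Real.norm_of_nonneg (inv_nonneg.2 hε.le)]
  gcongr
  exact (norm_sub_le _ _).trans (add_le_add ((norm_sub_le _ _).trans (add_le_add
    ((dualIncl j).le_opNorm_of_le hG) ((dualIncl j).le_opNorm_of_le hM))) (b.le_opNorm_of_le hR))

theorem map_diffQuot_u [CompleteSpace H] (hz : IsWeakSolution j b ε u v g) {h : ℝ} (hh : h ≠ 0)
    (t : ℝ) : j (h⁻¹ • (u (t + h) - u t)) = timeAverage v h t := by
  rw [timeAverage_eq_of_hasDerivAt hz.hasDerivAt_u hz.continuous_v hh, map_smul, map_sub]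

theorem dualIncl_diffQuot_v (hz : IsWeakSolution j b ε u v g) {h : ℝ} (hh : h ≠ 0) (t : ℝ) :
    dualIncl j (h⁻¹ • (v (t + h) - v t)) = timeAverage (accel j b ε u v g) h t := by
  rw [timeAverage_eq_of_hasDerivAt hz.hasDerivAt_v hz.continuous_accel hh, map_smul, map_sub]

theorem timeAverage_accel [CompleteSpace V] [CompleteSpace H] (hz : IsWeakSolution j b ε u v g)
    (h t : ℝ) : timeAverage (accel j b ε u v g) h t
      = accel j b ε (timeAverage u h) (timeAverage v h) (timeAverage g h) t := by
  have hu := hz.continuous_u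
  have hv := hz.continuous_v
  have hg := hz.continuous_g
  unfold accel
  rw [timeAverage_const_smul, timeAverage_sub (by fun_prop) (by fun_prop),
    timeAverage_sub (by fun_prop) (by fun_prop), map_timeAverage _ hu, map_timeAverage _ hv,
    map_timeAverage _ hg]

/-- The energy identity. The solution is too irregular to be tested with `v`; its time averages,
which solve the averaged equation, are not, and the averaging length then tends to zero. -/
theorem energy_identity [CompleteSpace V] [CompleteSpace H] (hz : IsWeakSolution j b ε u v g)
    (hε : ε ≠ 0) (hsymm : ∀ x y, b x y = b y x) (s t : ℝ) :
    (b (u t) (u t) + ε * ‖v t‖ ^ 2) / 2 - (b (u s) (u s) + ε * ‖v s‖ ^ 2) / 2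
      = ∫ τ in s..t, (inner ℝ (g τ) (v τ) - ‖v τ‖ ^ 2) := by
  have hu := hz.continuous_u
  have hv := hz.continuous_v
  have hg := hz.continuous_g
  set e : ℝ → ℝ → ℝ := fun h t =>
    (b (timeAverage u h t) (timeAverage u h t) + ε * ‖timeAverage v h t‖ ^ 2) / 2 with he
  have hu' := continuous_timeAverage hu
  have hv' := continuous_timeAverage hv
  have hg' := continuous_timeAverage hg
  have havg : ∀ h, h ≠ 0 → e h t - e h s
      = ∫ τ in s..t, (inner ℝ (timeAverage g h τ) (timeAverage v h τ)
          - ‖timeAverage v h τ‖ ^ 2) := by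
    intro h hh
    have hgc : Continuous (timeAverage g h) := continuous_timeAverage_right hg h
    have hvc : Continuous (timeAverage v h) := continuous_timeAverage_right hv h
    symm
    apply intervalIntegral.integral_eq_sub_of_hasDerivAt
    · intro τ _
      have h1 := hasDerivAt_timeAverage hu hh τ
      have h2 := hasDerivAt_timeAverage hv hh τ
      have h3 := ((b.hasFDerivAt.comp_hasDerivAt τ h1).clm_apply h1).add
        ((h2.norm_sq).const_mul ε) |>.div_const 2
      refine h3.congr_deriv ?_
      have h4 : ε * inner ℝ (timeAverage v h τ) (h⁻¹ • (v (τ + h) - v τ))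
          = inner ℝ (timeAverage g h τ) (timeAverage v h τ)
            - ‖timeAverage v h τ‖ ^ 2 - b (timeAverage u h τ) (h⁻¹ • (u (τ + h) - u τ)) := by
        rw [real_inner_comm]
        nth_rewrite 1 [← hz.map_diffQuot_u hh]
        rw [← dualIncl_apply, hz.dualIncl_diffQuot_v hh, hz.timeAverage_accel, accel,
          smul_apply, sub_apply, sub_apply, dualIncl_apply, dualIncl_apply,
          hz.map_diffQuot_u hh, real_inner_self_eq_norm_sq, smul_eq_mul, mul_inv_cancel_left₀ hε]
      have h5 := hsymm (h⁻¹ • (u (τ + h) - u τ)) (timeAverage u h τ)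
      rw [h5]
      simp only [Function.comp_apply]
      linear_combination h4
    · exact Continuous.intervalIntegrable (by fun_prop) _ _
  have hec : ∀ t, Continuous fun h => e h t := by
    intro t
    have h1 := continuous_timeAverage_left hu t
    have h2 := continuous_timeAverage_left hz.continuous_v t
    fun_prop
  have hic : Continuous fun h => ∫ τ in s..t,
      (inner ℝ (timeAverage g h τ) (timeAverage v h τ) - ‖timeAverage v h τ‖ ^ 2) := by
    apply intervalIntegral.continuous_parametric_intervalIntegral_of_continuous'
    exact (hg'.inner hv').sub (hv'.norm.pow 2)
  have h1 := (((hec t).sub (hec s)).tendsto 0).mono_left (nhdsWithin_le_nhds (s := {0}ᶜ))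
  have h2 := (hic.tendsto 0).mono_left (nhdsWithin_le_nhds (s := {0}ᶜ))
  have h3 := tendsto_nhds_unique_of_eventuallyEq h1 h2
    (by filter_upwards [self_mem_nhdsWithin] with h hh using havg h hh)
  simpa only [he, Pi.sub_apply, Pi.add_apply, timeAverage_zero] using h3

variable {S : StrongDual ℝ V →L[ℝ] V}

/-- If `S` inverts a symmetric form `b`, then `w₁ (S w₂)` is symmetric on `V'`. -/
theorem dual_symm (hsymm : ∀ x y, b x y = b y x) (hS : ∀ w, b (S w) = w) (w₁ w₂ : StrongDual ℝ V) :
    w₁ (S w₂) = w₂ (S w₁) := by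
  rw [← congrArg (· (S w₂)) (hS w₁), ← congrArg (· (S w₁)) (hS w₂)]
  exact hsymm _ _

theorem dual_nonneg (hpos : ∀ x, 0 ≤ b x x) (hS : ∀ w, b (S w) = w) (w : StrongDual ℝ V) :
    0 ≤ w (S w) := by
  have := hpos (S w)
  rwa [hS w] at this

theorem hasDerivAt_dual_form {w : ℝ → StrongDual ℝ V} {w' : StrongDual ℝ V} {t : ℝ}
    (hsymm : ∀ x y, b x y = b y x) (hS : ∀ w, b (S w) = w) (hw : HasDerivAt w w' t) :
    HasDerivAt (fun s => w s (S (w s))) (2 * w t (S w')) t := by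
  have h1 : HasDerivAt (fun s => S (w s)) (S w') t := S.hasFDerivAt.comp_hasDerivAt t hw
  refine (hw.clm_apply h1).congr_deriv ?_
  rw [dual_symm hsymm hS w' (w t), two_mul]

/-- The energy inequality in `H × V'` for the difference quotients in time of a weak solution. -/
theorem diffQuot_energy_le [CompleteSpace V] [CompleteSpace H] (hz : IsWeakSolution j b ε u v g)
    (hε : ε ≠ 0) (hsymm : ∀ x y, b x y = b y x) (hpos : ∀ x, 0 ≤ b x x) (hS : ∀ w, b (S w) = w)
    {L : ℝ} (hL : 0 ≤ L)
    (hg : ∀ s t ζ, |inner ℝ (g t - g s) (j ζ)| ≤ L * ‖j (u t - u s)‖ * ‖ζ‖) {s t : ℝ}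
    (hst : s ≤ t) {h : ℝ} (hh : h ≠ 0) :
    let w := timeAverage (accel j b ε u v g)
    ‖timeAverage v h t‖ ^ 2 + ε * w h t (S (w h t)) + ∫ τ in s..t, w h τ (S (w h τ))
      ≤ ‖timeAverage v h s‖ ^ 2 + ε * w h s (S (w h s))
        + ‖S‖ * L ^ 2 * ∫ τ in s..t, ‖timeAverage v h τ‖ ^ 2 := by
  intro w
  have hw : w = timeAverage (accel j b ε u v g) := rfl
  clear_value w
  have hgc := hz.continuous_g
  have hac := hz.continuous_accel
  have hvc : Continuous (timeAverage v h) := continuous_timeAverage_right hz.continuous_v h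
  have hwc : Continuous (w h) := by
    rw [hw]
    exact continuous_timeAverage_right hac h
  set G : ℝ → StrongDual ℝ V := fun τ => dualIncl j (h⁻¹ • (g (τ + h) - g τ)) with hG
  have hGc : Continuous G := by fun_prop
  have hder : ∀ τ, HasDerivAt (fun τ => ‖timeAverage v h τ‖ ^ 2 + ε * w h τ (S (w h τ)))
      (2 * w h τ (S (G τ)) - 2 * w h τ (S (w h τ))) τ := by
    intro τ
    have h1 := hasDerivAt_timeAverage hz.continuous_v hh τ
    have h2 := hasDerivAt_timeAverage hac hh τ
    rw [← hw] at h2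
    have h3 := h1.norm_sq.add ((hasDerivAt_dual_form hsymm hS h2).const_mul ε)
    refine h3.congr_deriv ?_
    have h4 : ε • (h⁻¹ • (accel j b ε u v g (τ + h) - accel j b ε u v g τ))
        = G τ - w h τ - b (h⁻¹ • (u (τ + h) - u τ)) := by
      rw [hw, ← hz.dualIncl_diffQuot_v hh, hG, smul_comm ε]
      simp only [accel, map_smul, map_sub]
      match_scalars <;> field_simp
    have h5 : w h τ (S (b (h⁻¹ • (u (τ + h) - u τ))))
        = inner ℝ (timeAverage v h τ) (h⁻¹ • (v (τ + h) - v τ)) := by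
      rw [dual_symm hsymm hS, hsymm, hS, hw, ← hz.dualIncl_diffQuot_v hh, dualIncl_apply,
        hz.map_diffQuot_u hh, real_inner_comm]
    have h6 := congrArg (fun x => w h τ (S x)) h4
    simp only [map_smul, map_sub, smul_eq_mul] at h6 h5 ⊢
    linear_combination 2 * h6 - 2 * h5
  have hle : ∀ τ, 2 * w h τ (S (G τ)) - 2 * w h τ (S (w h τ))
      ≤ ‖S‖ * L ^ 2 * ‖timeAverage v h τ‖ ^ 2 - w h τ (S (w h τ)) := by
    intro τ
    have h1 := dual_nonneg hpos hS (w h τ - G τ)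
    have h2 := dual_symm hsymm hS (G τ) (w h τ)
    simp only [map_sub, sub_apply] at h1
    have h3 : ‖G τ‖ ≤ L * ‖timeAverage v h τ‖ := by
      refine ContinuousLinearMap.opNorm_le_bound _ (by positivity) fun ζ => ?_
      have h4 := hg τ (τ + h) ζ
      change |inner ℝ (h⁻¹ • (g (τ + h) - g τ)) (j ζ)| ≤ _
      rw [← hz.map_diffQuot_u hh, real_inner_smul_left, map_smul, norm_smul, abs_mul,
        Real.norm_eq_abs]
      calc |h⁻¹| * |inner ℝ (g (τ + h) - g τ) (j ζ)|
          ≤ |h⁻¹| * (L * ‖j (u (τ + h) - u τ)‖ * ‖ζ‖) := by gcongr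
        _ = _ := by ring
    have h5 : G τ (S (G τ)) ≤ ‖S‖ * L ^ 2 * ‖timeAverage v h τ‖ ^ 2 := calc
      G τ (S (G τ)) ≤ ‖G τ (S (G τ))‖ := le_abs_self _
      _ ≤ ‖G τ‖ * (‖S‖ * ‖G τ‖) := (G τ).le_opNorm_of_le (S.le_opNorm _)
      _ ≤ (L * ‖timeAverage v h τ‖) * (‖S‖ * (L * ‖timeAverage v h τ‖)) := by gcongr
      _ = _ := by ring
    linarith
  have h1 := intervalIntegral.integral_eq_sub_of_hasDerivAt (a := s) (b := t)
    (fun τ _ => hder τ) (Continuous.intervalIntegrable (by fun_prop) _ _)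
  have h2 := intervalIntegral.integral_mono_on (μ := volume) hst
    (Continuous.intervalIntegrable (by fun_prop) _ _)
    (Continuous.intervalIntegrable (by fun_prop) _ _) fun τ _ => hle τ
  rw [h1, intervalIntegral.integral_sub (Continuous.intervalIntegrable (by fun_prop) _ _)
    (Continuous.intervalIntegrable (by fun_prop) _ _), intervalIntegral.integral_const_mul] at h2
  linarith

/-- The energy inequality for `(∂ₜu, ∂ₜ²u)` in `H × V'`, where `V'` carries the scalar product
`w₁ (S w₂)`. It is the energy estimate of difference quotients in time, which are regular enough
for this weaker norm; the difference quotients of `g` are only estimated in `V'`. -/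
theorem derivative_energy_le [CompleteSpace V] [CompleteSpace H] (hz : IsWeakSolution j b ε u v g)
    (hε : ε ≠ 0) (hsymm : ∀ x y, b x y = b y x) (hpos : ∀ x, 0 ≤ b x x) (hS : ∀ w, b (S w) = w)
    {L : ℝ} (hL : 0 ≤ L)
    (hg : ∀ s t ζ, |inner ℝ (g t - g s) (j ζ)| ≤ L * ‖j (u t - u s)‖ * ‖ζ‖) {s t : ℝ}
    (hst : s ≤ t) :
    ‖v t‖ ^ 2 + ε * accel j b ε u v g t (S (accel j b ε u v g t))
        + ∫ τ in s..t, accel j b ε u v g τ (S (accel j b ε u v g τ))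
      ≤ ‖v s‖ ^ 2 + ε * accel j b ε u v g s (S (accel j b ε u v g s))
        + ‖S‖ * L ^ 2 * ∫ τ in s..t, ‖v τ‖ ^ 2 := by
  set w := accel j b ε u v g with hw
  have hwc : Continuous w := hz.continuous_accel
  have hv' := continuous_timeAverage hz.continuous_v
  have hw' := continuous_timeAverage hwc
  set e : ℝ → ℝ → ℝ := fun h t =>
    ‖timeAverage v h t‖ ^ 2 + ε * timeAverage w h t (S (timeAverage w h t)) with he
  have havg : ∀ h, h ≠ 0 →
      e h t + ∫ τ in s..t, timeAverage w h τ (S (timeAverage w h τ))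
        ≤ e h s + ‖S‖ * L ^ 2 * ∫ τ in s..t, ‖timeAverage v h τ‖ ^ 2 := fun h hh =>
    hz.diffQuot_energy_le hε hsymm hpos hS hL hg hst hh
  have hec : ∀ t, Continuous fun h => e h t := by
    intro t
    have h1 := continuous_timeAverage_left hz.continuous_v t
    have h2 := continuous_timeAverage_left hwc t
    fun_prop
  have hiw : Continuous fun h =>
      ∫ τ in s..t, timeAverage w h τ (S (timeAverage w h τ)) := by
    apply intervalIntegral.continuous_parametric_intervalIntegral_of_continuous'
    exact hw'.clm_apply (S.continuous.comp hw')
  have hiv : Continuous fun h => ∫ τ in s..t, ‖timeAverage v h τ‖ ^ 2 := by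
    apply intervalIntegral.continuous_parametric_intervalIntegral_of_continuous'
    exact hv'.norm.pow 2
  have h1 := (((hec t).add hiw).tendsto 0).mono_left (nhdsWithin_le_nhds (s := {0}ᶜ))
  have h2 := (((hec s).add (hiv.const_mul (‖S‖ * L ^ 2))).tendsto 0).mono_left
    (nhdsWithin_le_nhds (s := {0}ᶜ))
  have h3 := le_of_tendsto_of_tendsto h1 h2
    (by filter_upwards [self_mem_nhdsWithin] with h hh using havg h hh)
  simpa only [he, Pi.sub_apply, Pi.add_apply, timeAverage_zero] using h3

/-- The bound on `(∂ₜu, ∂ₜ²u)` in terms of the dissipation integral alone. Once the energy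
of `(∂ₜu, ∂ₜ²u)` is bounded, the energy inequality makes it integrable over `(-∞, t]`, hence
arbitrarily small at suitable times in the distant past, so that the initial energy drops out. The
bounds `R`, `M`, `G` may depend on `ε`; they do not enter the result. -/
theorem derivative_energy_le_of_bounded [CompleteSpace V] [CompleteSpace H]
    (hz : IsWeakSolution j b ε u v g) (hε : 0 < ε) (hsymm : ∀ x y, b x y = b y x)
    (hpos : ∀ x, 0 ≤ b x x) (hS : ∀ w, b (S w) = w) {L D R M G : ℝ} (hL : 0 ≤ L)
    (hg : ∀ s t ζ, |inner ℝ (g t - g s) (j ζ)| ≤ L * ‖j (u t - u s)‖ * ‖ζ‖)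
    (hD : ∀ s t, s ≤ t → ∫ τ in s..t, ‖v τ‖ ^ 2 ≤ D)
    (hR : ∀ t, ‖u t‖ ≤ R) (hM : ∀ t, ‖v t‖ ≤ M) (hG : ∀ t, ‖g t‖ ≤ G) (t : ℝ) :
    ‖v t‖ ^ 2 + ε * accel j b ε u v g t (S (accel j b ε u v g t)) ≤ ‖S‖ * L ^ 2 * D := by
  have hvc := hz.continuous_v
  have hwc := hz.continuous_accel
  have hen := fun {s t : ℝ} (hst : s ≤ t) =>
    hz.derivative_energy_le hε.ne' hsymm hpos hS hL hg hst
  obtain ⟨A, hA⟩ : ∃ A, ∀ t, ‖accel j b ε u v g t‖ ≤ A :=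
    ⟨_, fun t => norm_accel_le hε (hR t) (hM t) (hG t)⟩
  set w := accel j b ε u v g
  set e : ℝ → ℝ := fun t => ‖v t‖ ^ 2 + ε * w t (S (w t)) with he
  have hec : Continuous e := by fun_prop
  set K := ‖S‖ * L ^ 2 with hK
  have hK0 : 0 ≤ K := by positivity
  have hKD : ∀ s t, s ≤ t → K * ∫ τ in s..t, ‖v τ‖ ^ 2 ≤ K * D := fun s t hst =>
    mul_le_mul_of_nonneg_left (hD s t hst) hK0
  have hint : ∀ s t, s ≤ t → 0 ≤ ∫ τ in s..t, w τ (S (w τ)) := fun s t hst =>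
    intervalIntegral.integral_nonneg hst fun τ _ => dual_nonneg hpos hS _
  have heM : ∀ s, e s ≤ M ^ 2 + ε * (A * (‖S‖ * A)) := by
    intro s
    have h1 : w s (S (w s)) ≤ A * (‖S‖ * A) := calc
      w s (S (w s)) ≤ ‖w s (S (w s))‖ := le_abs_self _
      _ ≤ ‖w s‖ * (‖S‖ * ‖w s‖) := (w s).le_opNorm_of_le (S.le_opNorm _)
      _ ≤ _ := by
        have := hA s
        have := (norm_nonneg _).trans this
        gcongr
    have h2 := hM s
    simp only [he]
    gcongr
  set M' := D + ε * (M ^ 2 + ε * (A * (‖S‖ * A)) + K * D) with hM'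
  -- the energy inequality from `τ` to `t`, integrated over all `τ ∈ [t - n, t]`
  have hmain : ∀ n : ℕ, n * (e t - K * D) ≤ M' := by
    intro n
    have hst : t - n ≤ t := by simp
    have h1 : ∫ τ in (t - n)..t, (e t - K * D) ≤ ∫ τ in (t - n)..t, e τ := by
      refine intervalIntegral.integral_mono_on hst (by simp) (hec.intervalIntegrable _ _) ?_
      intro τ hτ
      have := hen hτ.2
      have := hint τ t hτ.2
      have := hKD τ t hτ.2
      simp only [he]
      linarith
    have h2 : ∫ τ in (t - n)..t, e τ
        = (∫ τ in (t - n)..t, ‖v τ‖ ^ 2) + ε * ∫ τ in (t - n)..t, w τ (S (w τ)) := by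
      rw [he, intervalIntegral.integral_add (Continuous.intervalIntegrable (by fun_prop) _ _)
        (Continuous.intervalIntegrable (by fun_prop) _ _), intervalIntegral.integral_const_mul]
    have h3 : ∫ τ in (t - n)..t, w τ (S (w τ)) ≤ M ^ 2 + ε * (A * (‖S‖ * A)) + K * D := by
      have h4 := hen hst
      have h5 : 0 ≤ ‖v t‖ ^ 2 + ε * w t (S (w t)) :=
        add_nonneg (sq_nonneg _) (mul_nonneg hε.le (dual_nonneg hpos hS _))
      have h6 := heM (t - n)
      have h7 := hKD _ _ hst
      simp only [he] at h6
      linarith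
    rw [intervalIntegral.integral_const, smul_eq_mul, sub_sub_cancel, h2] at h1
    have h8 := hD _ _ hst
    have h9 := mul_le_mul_of_nonneg_left h3 hε.le
    linarith
  by_contra! hlt
  have hlt : 0 < e t - K * D := sub_pos.2 hlt
  obtain ⟨n, hn⟩ := exists_nat_gt (M' / (e t - K * D))
  rw [div_lt_iff₀ hlt] at hn
  exact (hmain n).not_gt hn

/-- A form of the bound that separates the constant, which depends neither on `ε` nor on the
solution, from the qualitative boundedness assumptions. -/
theorem exists_derivative_energy_bound [CompleteSpace V] [CompleteSpace H]
    (hsymm : ∀ x y, b x y = b y x) (hpos : ∀ x, 0 ≤ b x x) (hS : ∀ w, b (S w) = w) {L D : ℝ}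
    (hL : 0 ≤ L) (hD0 : 0 ≤ D) :
    ∃ C, 0 ≤ C ∧ ∀ {ε : ℝ} {u : ℝ → V} {v g : ℝ → H} {R M G : ℝ}, 0 < ε →
      IsWeakSolution j b ε u v g →
      (∀ s t ζ, |inner ℝ (g t - g s) (j ζ)| ≤ L * ‖j (u t - u s)‖ * ‖ζ‖) →
      (∀ s t, s ≤ t → ∫ τ in s..t, ‖v τ‖ ^ 2 ≤ D) →
      (∀ t, ‖u t‖ ≤ R) → (∀ t, ‖v t‖ ≤ M) → (∀ t, ‖g t‖ ≤ G) →
      ∀ t, ‖v t‖ ^ 2 + ε * accel j b ε u v g t (S (accel j b ε u v g t)) ≤ C :=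
  ⟨‖S‖ * L ^ 2 * D, by positivity, fun hε hz hg hD hR hM hG =>
    hz.derivative_energy_le_of_bounded hε hsymm hpos hS hL hg hD hR hM hG⟩

end IsWeakSolution

end Energy

/-! ### The bilinear form on `H¹₀(Ω)` -/

section Form

variable {Ω : Opens E3}

theorem norm_sq_eq_integral {E : Type*} [NormedAddCommGroup E] [InnerProductSpace ℝ E]
    (g : Lp E 2 (vol Ω)) : ‖g‖ ^ 2 = ∫ x, ‖g x‖ ^ 2 ∂vol Ω := by
  rw [← real_inner_self_eq_norm_sq, L2.inner_def]
  simp only [real_inner_self_eq_norm_sq]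

theorem norm_sq_eq (u : H10 Ω) : ‖u‖ ^ 2 = ‖toL2 Ω u‖ ^ 2 + ‖grad Ω u‖ ^ 2 :=
  WithLp.prod_norm_sq_eq_of_L2 (u : WithLp 2 (L2 Ω × L2vec Ω))

theorem norm_toL2_le (u : H10 Ω) : ‖toL2 Ω u‖ ≤ ‖u‖ := by
  have := norm_sq_eq u
  exact (pow_le_pow_iff_left₀ (norm_nonneg _) (norm_nonneg _) two_ne_zero).1 <| by
    nlinarith [sq_nonneg ‖grad Ω u‖]

theorem formFun_congr (a : Fin 3 → Fin 3 → E3 → ℝ) (β : E3 → ℝ) {u u' v v' : E3 → ℝ}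
    {gu gu' gv gv' : E3 → E3} (hu : u =ᵐ[vol Ω] u') (hgu : gu =ᵐ[vol Ω] gu')
    (hv : v =ᵐ[vol Ω] v') (hgv : gv =ᵐ[vol Ω] gv') :
    formFun Ω a β u gu v gv = formFun Ω a β u' gu' v' gv' := by
  unfold formFun
  congr 1
  · refine integral_congr_ae ?_
    filter_upwards [hgu, hgv] with x h1 h2
    simp only [h1, h2]
  · refine integral_congr_ae ?_
    filter_upwards [hu, hv] with x h1 h2
    simp only [h1, h2]

theorem h1Inner_smul_left {a : Fin 3 → Fin 3 → E3 → ℝ} {β : E3 → ℝ} (c : ℝ) (u v : H10 Ω) :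
    h1Inner a β (c • u) v = c * h1Inner a β u v := by
  unfold h1Inner
  rw [map_smul, map_smul,
    formFun_congr a β (Lp.coeFn_smul _ _) (Lp.coeFn_smul _ _) ae_eq_rfl ae_eq_rfl]
  unfold formFun
  rw [mul_add, ← integral_const_mul, ← integral_const_mul]
  simp only [Pi.smul_apply, PiLp.smul_apply, smul_eq_mul, Finset.mul_sum]
  congr 1 <;> refine integral_congr_ae (ae_of_all _ fun x => ?_)
  · exact Finset.sum_congr rfl fun i _ => Finset.sum_congr rfl fun j _ => by ring
  · simp only
    ring

namespace LinearAssumption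

variable {a₀ a₁ : ℝ} {a : Fin 3 → Fin 3 → E3 → ℝ} {β : E3 → ℝ}

theorem integrable_principal (h : LinearAssumption Ω a₀ a₁ a β) (g g' : L2vec Ω) :
    Integrable (fun x => ∑ i, ∑ j, a i j x * g x j * g' x i) (vol Ω) := by
  have hc : ∀ (g : L2vec Ω) (i : Fin 3), MemLp (fun x => g x i) 2 (vol Ω) := fun g i =>
    (EuclideanSpace.proj (𝕜 := ℝ) i).comp_memLp' (Lp.memLp g)
  refine integrable_finsetSum _ fun i _ => integrable_finsetSum _ fun j _ => ?_
  simp only [mul_assoc]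
  have h1 : MemLp (fun x => g x j * g' x i) 1 (vol Ω) :=
    memLp_one_iff_integrable.2 ((hc g j).integrable_mul (hc g' i))
  exact (h.memLinfty i j).integrable_mul h1

theorem exists_zeroOrder_bound (h : LinearAssumption Ω a₀ a₁ a β) {δ : ℝ} (hδ : 0 < δ) :
    ∃ C : ℝ, 0 ≤ C ∧ ∀ u : H10 Ω, Integrable (fun x => |β x| * toL2 Ω u x ^ 2) (vol Ω) ∧
      ∫ x, |β x| * toL2 Ω u x ^ 2 ∂vol Ω ≤ δ * ‖u‖ ^ 2 + C * ‖toL2 Ω u‖ ^ 2 := by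
  obtain ⟨C, hC, hb⟩ := h.β_bound δ hδ
  refine ⟨C, hC, fun u => ?_⟩
  have hm : AEStronglyMeasurable (fun x => |β x| * toL2 Ω u x ^ 2) (vol Ω) :=
    (h.β_meas.aestronglyMeasurable.norm).mul ((Lp.aestronglyMeasurable (toL2 Ω u)).pow 2)
  have hnn : 0 ≤ᵐ[vol Ω] fun x => |β x| * toL2 Ω u x ^ 2 := ae_of_all _ fun x => by positivity
  constructor
  · refine ⟨hm, (hasFiniteIntegral_iff_ofReal hnn).2 ((hb u).trans_lt ENNReal.ofReal_lt_top)⟩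
  · rw [integral_eq_lintegral_of_nonneg_ae hnn hm]
    exact ENNReal.toReal_le_of_le_ofReal (by positivity) (hb u)

theorem integrable_zeroOrder (h : LinearAssumption Ω a₀ a₁ a β) (u v : H10 Ω) :
    Integrable (fun x => β x * toL2 Ω u x * toL2 Ω v x) (vol Ω) := by
  obtain ⟨C, -, hb⟩ := h.exists_zeroOrder_bound one_pos
  refine ((hb u).1.add (hb v).1).mono' ?_ (ae_of_all _ fun x => ?_)
  · exact (h.β_meas.aestronglyMeasurable.mul (Lp.aestronglyMeasurable _)).mul
      (Lp.aestronglyMeasurable _)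
  · have h1 : |toL2 Ω u x| * |toL2 Ω v x| ≤ toL2 Ω u x ^ 2 + toL2 Ω v x ^ 2 := by
      rw [← sq_abs (toL2 Ω u x), ← sq_abs (toL2 Ω v x)]
      nlinarith [sq_nonneg (|toL2 Ω u x| - |toL2 Ω v x|), sq_nonneg (|toL2 Ω u x|),
        sq_nonneg (|toL2 Ω v x|)]
    simp only [Real.norm_eq_abs, abs_mul, Pi.add_apply]
    rw [mul_assoc, ← mul_add]
    gcongr

theorem h1Inner_comm (h : LinearAssumption Ω a₀ a₁ a β) (u v : H10 Ω) :
    h1Inner a β u v = h1Inner a β v u := by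
  unfold h1Inner formFun
  congr 1
  · have hs : ∀ᵐ x ∂vol Ω, ∀ i j, a i j x = a j i x :=
      ae_all_iff.2 fun i => ae_all_iff.2 fun j => h.symm i j
    refine integral_congr_ae ?_
    filter_upwards [hs] with x hx
    rw [Finset.sum_comm]
    refine Finset.sum_congr rfl fun i _ => Finset.sum_congr rfl fun j _ => ?_
    rw [hx j i]
    ring
  · refine integral_congr_ae (ae_of_all _ fun x => ?_)
    simp only
    ring

theorem h1Inner_add_left (h : LinearAssumption Ω a₀ a₁ a β) (u u' v : H10 Ω) :
    h1Inner a β (u + u') v = h1Inner a β u v + h1Inner a β u' v := by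
  unfold h1Inner
  rw [map_add, map_add, formFun_congr a β (Lp.coeFn_add _ _) (Lp.coeFn_add _ _) ae_eq_rfl ae_eq_rfl]
  unfold formFun
  rw [add_add_add_comm, ← integral_add (h.integrable_principal _ _) (h.integrable_principal _ _),
    ← integral_add (h.integrable_zeroOrder _ _) (h.integrable_zeroOrder _ _)]
  simp only [Pi.add_apply, PiLp.add_apply, mul_add, add_mul, Finset.sum_add_distrib]

theorem h1Inner_add_smul_self (h : LinearAssumption Ω a₀ a₁ a β) (u v : H10 Ω) (c : ℝ) :
    h1Inner a β (u + c • v) (u + c • v)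
      = h1Inner a β u u + 2 * c * h1Inner a β u v + c ^ 2 * h1Inner a β v v := by
  rw [h.h1Inner_add_left, h1Inner_smul_left, h.h1Inner_comm u (u + c • v),
    h.h1Inner_comm v (u + c • v), h.h1Inner_add_left, h.h1Inner_add_left, h1Inner_smul_left,
    h1Inner_smul_left, h.h1Inner_comm v u]
  ring

theorem h1Inner_self_bounds (h : LinearAssumption Ω a₀ a₁ a β) {δ : ℝ} (hδ : 0 < δ) :
    ∃ C : ℝ, 0 ≤ C ∧ ∀ u : H10 Ω,
      a₀ * ‖grad Ω u‖ ^ 2 - (δ * ‖u‖ ^ 2 + C * ‖toL2 Ω u‖ ^ 2) ≤ h1Inner a β u u ∧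
      h1Inner a β u u ≤ a₁ * ‖grad Ω u‖ ^ 2 + (δ * ‖u‖ ^ 2 + C * ‖toL2 Ω u‖ ^ 2) := by
  obtain ⟨C, hC, hb⟩ := h.exists_zeroOrder_bound hδ
  refine ⟨C, hC, fun u => ?_⟩
  have h1 : |∫ x, β x * toL2 Ω u x * toL2 Ω u x ∂vol Ω| ≤ δ * ‖u‖ ^ 2 + C * ‖toL2 Ω u‖ ^ 2 := by
    rw [← Real.norm_eq_abs]
    refine (norm_integral_le_of_norm_le (hb u).1 (ae_of_all _ fun x => ?_)).trans (hb u).2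
    rw [mul_assoc, ← sq, norm_mul, Real.norm_eq_abs, norm_pow, Real.norm_eq_abs, sq_abs]
  have hgi : Integrable (fun x => ‖grad Ω u x‖ ^ 2) (vol Ω) :=
    (Lp.memLp (grad Ω u)).integrable_norm_pow (by simp)
  have h2 : a₀ * ‖grad Ω u‖ ^ 2 ≤ ∫ x, ∑ i, ∑ j, a i j x * grad Ω u x j * grad Ω u x i ∂vol Ω := by
    rw [norm_sq_eq_integral, ← integral_const_mul]
    refine integral_mono_ae (hgi.const_mul _) (h.integrable_principal _ _) ?_
    filter_upwards [h.elliptic] with x hx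
    simpa only [mul_assoc, mul_comm (grad Ω u x _) (grad Ω u x _)] using (hx (grad Ω u x)).1
  have h3 : ∫ x, ∑ i, ∑ j, a i j x * grad Ω u x j * grad Ω u x i ∂vol Ω ≤ a₁ * ‖grad Ω u‖ ^ 2 := by
    rw [norm_sq_eq_integral, ← integral_const_mul]
    refine integral_mono_ae (h.integrable_principal _ _) (hgi.const_mul _) ?_
    filter_upwards [h.elliptic] with x hx
    simpa only [mul_assoc, mul_comm (grad Ω u x _) (grad Ω u x _)] using (hx (grad Ω u x)).2
  rw [abs_le] at h1
  unfold h1Inner formFun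
  constructor <;> linarith [h1.1, h1.2]

/-- The norm `|·|_{H_1}` dominates the `H¹`-norm. The lower spectral bound controls `|u|_{L²}`,
ellipticity controls `|∇u|_{L²}` up to multiples of `|u|_{L²}`, and a suitable
combination gives both. -/
theorem exists_coercivity (h : LinearAssumption Ω a₀ a₁ a β) :
    ∃ κ : ℝ, 0 < κ ∧ ∀ u : H10 Ω, κ * ‖u‖ ^ 2 ≤ h1Inner a β u u := by
  have ha := h.a₀_pos
  obtain ⟨l, hl, hlow⟩ := h.coercive
  obtain ⟨C, hC, hb⟩ := h.h1Inner_self_bounds (half_pos ha)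
  refine ⟨(a₀ / 2) / (1 + (a₀ + C) / l), by positivity, fun u => ?_⟩
  have h1 := (hb u).1
  have h2 : l * ‖toL2 Ω u‖ ^ 2 ≤ h1Inner a β u u := by
    by_cases hu : toL2 Ω u = 0
    · -- here `u` has no multiple with `|u|_{L²} = 1`; the lower bound from ellipticity replaces it
      have h3 := norm_sq_eq u
      rw [hu] at h1 h3 ⊢
      simp only [norm_zero] at *
      nlinarith [sq_nonneg ‖grad Ω u‖]
    · have hn : 0 < ‖toL2 Ω u‖ := norm_pos_iff.2 hu
      have h3 := hlow (‖toL2 Ω u‖⁻¹ • u) (by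
        rw [map_smul, norm_smul, norm_inv, norm_norm, inv_mul_cancel₀ hn.ne'])
      rw [h1Inner_smul_left, h.h1Inner_comm, h1Inner_smul_left, ← mul_assoc] at h3
      calc l * ‖toL2 Ω u‖ ^ 2
          ≤ (‖toL2 Ω u‖⁻¹ * ‖toL2 Ω u‖⁻¹ * h1Inner a β u u) * ‖toL2 Ω u‖ ^ 2 := by gcongr
        _ = h1Inner a β u u := by field_simp
  have h3 := norm_sq_eq u
  rw [div_mul_eq_mul_div, div_le_iff₀ (by positivity)]
  have h4 : (a₀ + C) * ‖toL2 Ω u‖ ^ 2 ≤ h1Inner a β u u * ((a₀ + C) / l) := by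
    rw [mul_div_assoc', le_div_iff₀ hl]
    nlinarith
  nlinarith

theorem h1Inner_self_nonneg (h : LinearAssumption Ω a₀ a₁ a β) (u : H10 Ω) :
    0 ≤ h1Inner a β u u := by
  obtain ⟨κ, hκ, hb⟩ := h.exists_coercivity
  exact le_trans (by positivity) (hb u)

theorem exists_h1Inner_bound (h : LinearAssumption Ω a₀ a₁ a β) :
    ∃ C : ℝ, ∀ u v : H10 Ω, ‖h1Inner a β u v‖ ≤ C * ‖u‖ * ‖v‖ := by
  have ha := h.a₁_pos
  obtain ⟨C, hC, hb⟩ := h.h1Inner_self_bounds one_pos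
  have hself : ∀ u : H10 Ω, h1Inner a β u u ≤ (a₁ + 1 + C) * ‖u‖ ^ 2 := fun u => by
    have h1 := (hb u).2
    have h2 := norm_sq_eq u
    nlinarith [sq_nonneg ‖toL2 Ω u‖, sq_nonneg ‖grad Ω u‖]
  -- `0 ≤ ⟨u ± v, u ± v⟩` bounds `⟨u, v⟩` for unit vectors, and homogeneity does the rest
  have hunit : ∀ u v : H10 Ω, ‖u‖ = 1 → ‖v‖ = 1 → |h1Inner a β u v| ≤ a₁ + 1 + C := by
    intro u v hu hv
    have h1 := h.h1Inner_self_nonneg (u + (1 : ℝ) • v)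
    have h2 := h.h1Inner_self_nonneg (u + (-1 : ℝ) • v)
    have h3 := hself u
    have h4 := hself v
    rw [hu] at h3
    rw [hv] at h4
    rw [h.h1Inner_add_smul_self] at h1 h2
    rw [abs_le]
    constructor <;> linarith
  refine ⟨a₁ + 1 + C, fun u v => ?_⟩
  rcases eq_or_ne u 0 with rfl | hu
  · have := h1Inner_smul_left (a := a) (β := β) 0 0 v
    rw [zero_smul, zero_mul] at this
    simp [this]
  rcases eq_or_ne v 0 with rfl | hv
  · have := h1Inner_smul_left (a := a) (β := β) 0 0 u
    rw [zero_smul, zero_mul] at this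
    simp [h.h1Inner_comm u, this]
  have hnorm : ∀ u : H10 Ω, u ≠ 0 → ‖‖u‖⁻¹ • u‖ = 1 := fun u hu => by
    rw [norm_smul, norm_inv, norm_norm, inv_mul_cancel₀ (norm_ne_zero_iff.2 hu)]
  have h1 := hunit (‖u‖⁻¹ • u) (‖v‖⁻¹ • v) (hnorm u hu) (hnorm v hv)
  rw [h1Inner_smul_left, h.h1Inner_comm, h1Inner_smul_left, h.h1Inner_comm, abs_mul, abs_mul,
    abs_inv, abs_inv, abs_norm, abs_norm, ← mul_assoc, ← mul_inv, inv_mul_le_iff₀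
      (mul_pos (norm_pos_iff.2 hu) (norm_pos_iff.2 hv))] at h1
  rw [Real.norm_eq_abs]
  linarith

/-- The scalar product of `H_1` as a bounded bilinear form for the `H¹`-norm. -/
def form (h : LinearAssumption Ω a₀ a₁ a β) : H10 Ω →L[ℝ] H10 Ω →L[ℝ] ℝ :=
  LinearMap.mkContinuous₂
    (LinearMap.mk₂ ℝ (h1Inner a β) h.h1Inner_add_left h1Inner_smul_left
      (fun u v w => by
        rw [h.h1Inner_comm, h.h1Inner_add_left, h.h1Inner_comm v, h.h1Inner_comm w])
      (fun c u v => by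
        rw [h.h1Inner_comm, h1Inner_smul_left, h.h1Inner_comm v, smul_eq_mul]))
    h.exists_h1Inner_bound.choose h.exists_h1Inner_bound.choose_spec

theorem form_apply (h : LinearAssumption Ω a₀ a₁ a β) (u v : H10 Ω) :
    h.form u v = h1Inner a β u v := rfl

/-- The Lax–Milgram theorem for the form of `H_1`: every functional in `H_{-1}` is represented. -/
theorem exists_form_inverse (h : LinearAssumption Ω a₀ a₁ a β) :
    ∃ S : HNeg Ω →L[ℝ] H10 Ω, ∀ w, h.form (S w) = w := by
  obtain ⟨κ, hκ, hb⟩ := h.exists_coercivity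
  have hco : IsCoercive h.form := ⟨κ, hκ, fun u => by rw [mul_assoc, ← sq]; exact hb u⟩
  refine ⟨
    { toFun := fun w =>
        hco.continuousLinearEquivOfBilin.symm ((InnerProductSpace.toDual ℝ (H10 Ω)).symm w)
      map_add' := fun w w' => by simp
      map_smul' := fun c w => by simp
      cont := by fun_prop },
    fun w => ?_⟩
  ext ζ
  rw [← hco.continuousLinearEquivOfBilin_apply]
  simp

/-- The dual norm is bounded by the norm of the representing element of `H_1`. -/
theorem hNegNorm_sq_le (h : LinearAssumption Ω a₀ a₁ a β) {S : HNeg Ω →L[ℝ] H10 Ω}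
    (hS : ∀ w, h.form (S w) = w) (w : HNeg Ω) : hNegNorm a β w ^ 2 ≤ w (S w) := by
  have hw : w (S w) = h1Inner a β (S w) (S w) := (congrArg (· (S w)) (hS w)).symm
  have h0 : 0 ≤ w (S w) := hw ▸ h.h1Inner_self_nonneg _
  have hle : hNegNorm a β w ≤ √(w (S w)) := by
    refine Real.sSup_le ?_ (Real.sqrt_nonneg _)
    rintro _ ⟨ζ, hζ, rfl⟩
    apply Real.le_sqrt_of_sq_le
    rw [sq_abs]
    -- Cauchy-Schwarz for the form, from its nonnegativity at `S w - (w ζ) ζ`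
    have h1 := h.h1Inner_self_nonneg (S w + (-(w ζ)) • ζ)
    have h2 : h1Inner a β (S w) ζ = w ζ := by rw [← h.form_apply, hS]
    rw [h.h1Inner_add_smul_self, ← hw, h2] at h1
    nlinarith [mul_le_mul_of_nonneg_left (show h1Inner a β ζ ζ ≤ 1 from hζ) (sq_nonneg (w ζ))]
  have hnn : 0 ≤ hNegNorm a β w :=
    Real.sSup_nonneg (by rintro _ ⟨ζ, -, rfl⟩; exact abs_nonneg _)
  exact (pow_le_pow_left₀ hnn hle 2).trans_eq (Real.sq_sqrt h0)

/-- Density of `C_c^∞(Ω)`: an equation in the sense of distributions holds in `H_{-1}`. -/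
theorem form_eq_of_isEllipticOp (h : LinearAssumption Ω a₀ a₁ a β) {u : H10 Ω} {f : L2 Ω}
    (hu : IsEllipticOp a β u f) : h.form u = dualIncl (toL2 Ω) f := by
  have hd : DenseRange
      (fun p : testGraph Ω => (⟨p, (testGraph Ω).le_topologicalClosure p.2⟩ : H10 Ω)) :=
    (denseRange_inclusion_iff (testGraph Ω).le_topologicalClosure).2 subset_rfl
  refine DFunLike.coe_injective
    (hd.equalizer (h.form u).continuous (dualIncl (toL2 Ω) f).continuous (funext ?_))
  rintro ⟨p, φ, h1, h2⟩
  rw [Function.comp_apply, Function.comp_apply, form_apply, dualIncl_apply, L2.inner_def]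
  refine ((formFun_congr a β ae_eq_rfl ae_eq_rfl h1 h2).trans (hu φ)).trans ?_
  refine integral_congr_ae ?_
  filter_upwards [h1] with x hx
  rw [← hx, mul_comm]
  rfl

end LinearAssumption

end Form

/-! ### The Sobolev embedding `H¹₀(Ω) ⊂ L⁶(Ω)` -/

section Sobolev

variable {Ω : Opens E3}

theorem exists_sobolev_testGraph (Ω : Opens E3) :
    ∃ C : NNReal, ∀ p ∈ testGraph Ω, eLpNorm p.fst 6 (vol Ω) ≤ C * ‖p‖ₑ := by
  obtain ⟨K, hK⟩ : ∃ K, K = eLpNormLESNormFDerivOfEqInnerConst (volume : Measure E3)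
    ((2 : NNReal) : ℝ) := ⟨_, rfl⟩
  refine ⟨K, ?_⟩
  rintro p ⟨φ, h1, h2⟩
  have hgrad : ∀ x, ‖fderiv ℝ (φ : E3 → ℝ) x‖ = ‖∇ (φ : E3 → ℝ) x‖ := fun x => by
    simp [gradient]
  have hsupp : Function.support (∇ (φ : E3 → ℝ)) ⊆ (Ω : Set E3) := by
    refine fun x hx => φ.tsupport_subset (support_fderiv_subset ℝ (f := φ) ?_)
    rw [Function.mem_support] at hx ⊢
    rwa [← norm_ne_zero_iff, hgrad, norm_ne_zero_iff]
  calc eLpNorm p.fst 6 (vol Ω) = eLpNorm φ 6 (vol Ω) := eLpNorm_congr_ae h1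
    _ ≤ eLpNorm φ 6 volume := eLpNorm_mono_measure _ Measure.restrict_le_self
    _ ≤ K * eLpNorm (fderiv ℝ φ) 2 volume := by
      have := eLpNorm_le_eLpNorm_fderiv_of_eq_inner (volume : Measure E3) (u := φ)
        (φ.contDiff.of_le (by simp)) φ.hasCompactSupport (p := 2) (p' := 6) (by norm_num) (by simp)
        (by simp; norm_num)
      rw [← hK] at this
      exact_mod_cast this
    _ = K * eLpNorm (∇ (φ : E3 → ℝ)) 2 volume := by
      rw [eLpNorm_congr_norm_ae (ae_of_all _ hgrad)]
    _ = K * eLpNorm p.snd 2 (vol Ω) := by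
      rw [eLpNorm_congr_ae h2, eLpNorm_restrict_eq_of_support_subset hsupp]
    _ = K * ‖p.snd‖ₑ := by rw [Lp.enorm_def]
    _ ≤ _ := by
      gcongr
      exact enorm_le_iff_norm_le.2 (WithLp.norm_snd_le _ p)

/-- The Sobolev inequality, extended by density from `C_c^∞(Ω)` with Fatou's lemma. -/
theorem exists_sobolev (Ω : Opens E3) :
    ∃ C : NNReal, ∀ u : H10 Ω, eLpNorm (toL2 Ω u) 6 (vol Ω) ≤ C * ‖u‖ₑ := by
  obtain ⟨C, hC⟩ := exists_sobolev_testGraph Ω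
  refine ⟨C, ?_⟩
  rintro ⟨p, hp⟩
  obtain ⟨q, hq, hlim⟩ := mem_closure_iff_seq_limit.1 hp
  have hlim1 : Tendsto (fun n => (q n).fst) atTop (𝓝 p.fst) :=
    ((WithLp.fstL 2 ℝ (L2 Ω) (L2vec Ω)).continuous.tendsto p).comp hlim
  obtain ⟨ns, hns, hae⟩ := (tendstoInMeasure_of_tendsto_Lp hlim1).exists_seq_tendsto_ae
  have h1 := Lp.eLpNorm_lim_le_liminf_eLpNorm (p := 6)
    (fun n => Lp.aestronglyMeasurable (q (ns n)).fst) p.fst hae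
  have h2 : Tendsto (fun n => C * ‖q (ns n)‖ₑ) atTop (𝓝 (C * ‖p‖ₑ)) :=
    ENNReal.Tendsto.const_mul ((hlim.comp hns.tendsto_atTop).enorm) (Or.inr ENNReal.coe_ne_top)
  calc eLpNorm p.fst 6 (vol Ω)
      ≤ liminf (fun n => eLpNorm (q (ns n)).fst 6 (vol Ω)) atTop := h1
    _ ≤ liminf (fun n => C * ‖q (ns n)‖ₑ) atTop :=
      liminf_le_liminf (Eventually.of_forall fun n => hC _ (hq _))
    _ = C * ‖p‖ₑ := h2.liminf_eq

theorem eLpNorm_mul_mul_le {α : Type*} [MeasurableSpace α] {ν : Measure α} {f g h : α → ℝ}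
    (hf : AEStronglyMeasurable f ν) (hg : AEStronglyMeasurable g ν)
    (hh : AEStronglyMeasurable h ν) :
    eLpNorm (fun x => f x * (g x * h x)) 2 ν ≤ eLpNorm f 6 ν * (eLpNorm g 6 ν * eLpNorm h 6 ν) := by
  have e1 : ENNReal.HolderTriple 6 6 3 := ⟨by
    rw [← ENNReal.toReal_eq_toReal_iff' (by simp) (by simp), ENNReal.toReal_add (by simp) (by simp)]
    norm_num⟩
  have e2 : ENNReal.HolderTriple 6 3 2 := ⟨by
    rw [← ENNReal.toReal_eq_toReal_iff' (by simp) (by simp), ENNReal.toReal_add (by simp) (by simp)]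
    norm_num⟩
  calc _ ≤ eLpNorm f 6 ν * eLpNorm (fun x => g x * h x) 3 ν :=
        eLpNorm_smul_le_mul_eLpNorm (p := 6) (q := 3) (r := 2) (f := fun x => g x * h x) (φ := f)
          (hg.mul hh) hf
    _ ≤ _ := by
        gcongr
        exact eLpNorm_smul_le_mul_eLpNorm (p := 6) (q := 6) (r := 3) (f := h) (φ := g) hh hg

/-- Multiplication by the weight `1 + u² + v²` maps `H¹₀(Ω)` to `L²(Ω)`, because `H¹₀(Ω) ⊂ L⁶(Ω)`.
All estimates of the nonlinearity, whose growth is cubic, reduce to this one. -/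
theorem exists_weight_bound (Ω : Opens E3) :
    ∃ C : ℝ, 0 ≤ C ∧ ∀ u v ζ : H10 Ω,
      MemLp (fun x => (1 + toL2 Ω u x ^ 2 + toL2 Ω v x ^ 2) * toL2 Ω ζ x) 2 (vol Ω) ∧
      eLpNorm (fun x => (1 + toL2 Ω u x ^ 2 + toL2 Ω v x ^ 2) * toL2 Ω ζ x) 2 (vol Ω)
        ≤ ENNReal.ofReal (C * (1 + ‖u‖ ^ 2 + ‖v‖ ^ 2) * ‖ζ‖) := by
  obtain ⟨C, hC⟩ := exists_sobolev Ω
  have hm : ∀ u : H10 Ω, AEStronglyMeasurable (toL2 Ω u) (vol Ω) := fun u =>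
    Lp.aestronglyMeasurable _
  have hcub : ∀ u ζ : H10 Ω, eLpNorm (fun x => toL2 Ω u x * (toL2 Ω u x * toL2 Ω ζ x)) 2 (vol Ω)
      ≤ ENNReal.ofReal (C ^ 3 * ‖u‖ ^ 2 * ‖ζ‖) := fun u ζ => by
    refine (eLpNorm_mul_mul_le (hm u) (hm u) (hm ζ)).trans ?_
    have h1 : ∀ u : H10 Ω, eLpNorm (toL2 Ω u) 6 (vol Ω) ≤ ENNReal.ofReal (C * ‖u‖) := fun u => by
      refine (hC u).trans_eq ?_
      rw [ENNReal.ofReal_mul (by positivity), ofReal_norm, ENNReal.ofReal_coe_nnreal]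
    refine (mul_le_mul' (h1 u) (mul_le_mul' (h1 u) (h1 ζ))).trans_eq ?_
    rw [← ENNReal.ofReal_mul (by positivity), ← ENNReal.ofReal_mul (by positivity)]
    congr 1
    ring
  refine ⟨1 + C ^ 3, by positivity, fun u v ζ => ?_⟩
  have hle : eLpNorm (fun x => (1 + toL2 Ω u x ^ 2 + toL2 Ω v x ^ 2) * toL2 Ω ζ x) 2 (vol Ω)
        ≤ ENNReal.ofReal ((1 + C ^ 3) * (1 + ‖u‖ ^ 2 + ‖v‖ ^ 2) * ‖ζ‖) := by
    have e : (fun x => (1 + toL2 Ω u x ^ 2 + toL2 Ω v x ^ 2) * toL2 Ω ζ x)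
        = (toL2 Ω ζ : E3 → ℝ) + (fun x => toL2 Ω u x * (toL2 Ω u x * toL2 Ω ζ x))
          + fun x => toL2 Ω v x * (toL2 Ω v x * toL2 Ω ζ x) := by
      funext x
      simp only [Pi.add_apply]
      ring
    have hcm : ∀ u : H10 Ω,
        AEStronglyMeasurable (fun x => toL2 Ω u x * (toL2 Ω u x * toL2 Ω ζ x)) (vol Ω) := fun u =>
      (hm u).mul ((hm u).mul (hm ζ))
    rw [e]
    refine (eLpNorm_add_le ((hm ζ).add (hcm u)) (hcm v) (by norm_num)).trans ?_
    refine (add_le_add_left (eLpNorm_add_le (hm ζ) (hcm u) (by norm_num)) _).trans ?_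
    have h2 : eLpNorm (toL2 Ω ζ) 2 (vol Ω) ≤ ENNReal.ofReal ‖ζ‖ := by
      rw [← Lp.enorm_def, ← ofReal_norm]
      exact ENNReal.ofReal_le_ofReal (norm_toL2_le ζ)
    refine (add_le_add (add_le_add h2 (hcub u ζ)) (hcub v ζ)).trans ?_
    rw [← ENNReal.ofReal_add (by positivity) (by positivity),
      ← ENNReal.ofReal_add (by positivity) (by positivity)]
    apply ENNReal.ofReal_le_ofReal
    have h3 : 0 ≤ ((C : ℝ) ^ 3 + ‖u‖ ^ 2 + ‖v‖ ^ 2) * ‖ζ‖ := by positivity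
    nlinarith
  refine ⟨⟨?_, hle.trans_lt ENNReal.ofReal_lt_top⟩, hle⟩
  exact ((aestronglyMeasurable_const.add ((hm u).pow 2)).add ((hm v).pow 2)).mul (hm ζ)

end Sobolev

/-! ### The Nemitski operator and its potential -/

section PointwiseBounds

theorem sq_le_sq_add_sq_of_mem_uIcc {s u v : ℝ} (hs : s ∈ uIcc u v) : s ^ 2 ≤ u ^ 2 + v ^ 2 := by
  rcases le_total u v with h | h
  · rw [uIcc_of_le h] at hs
    rcases le_total 0 s with h0 | h0 <;> nlinarith [hs.1, hs.2, sq_nonneg u, sq_nonneg v]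
  · rw [uIcc_of_ge h] at hs
    rcases le_total 0 s with h0 | h0 <;> nlinarith [hs.1, hs.2, sq_nonneg u, sq_nonneg v]

theorem abs_sub_le_of_abs_iteratedDeriv_two_le {g : ℝ → ℝ} (hg : ContDiff ℝ 2 g) {M C : ℝ}
    (hC : 0 ≤ C) (h0 : |deriv g 0| ≤ M) (h2 : ∀ s, |iteratedDeriv 2 g s| ≤ C * (1 + |s|))
    (u v : ℝ) : |g u - g v| ≤ (M + 2 * C) * (1 + u ^ 2 + v ^ 2) * |u - v| := by
  have hM : 0 ≤ M := (abs_nonneg _).trans h0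
  have hd : Differentiable ℝ g := hg.differentiable (by norm_num)
  have hd2 : Differentiable ℝ (deriv g) := by
    have := hg.differentiable_iteratedDeriv 1 (by norm_num)
    rwa [iteratedDeriv_one] at this
  have h1 : ∀ s, |deriv g s| ≤ (M + 2 * C) * (1 + s ^ 2) := by
    intro s
    have h3 : ‖deriv g s - deriv g 0‖ ≤ C * (1 + |s|) * ‖s - 0‖ := by
      refine (convex_uIcc (0 : ℝ) s).norm_image_sub_le_of_norm_deriv_le (f := deriv g)
        (fun x _ => hd2 x) (fun x hx => ?_) left_mem_uIcc right_mem_uIcc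
      have h4 := h2 x
      rw [iteratedDeriv_succ, iteratedDeriv_one] at h4
      have h5 : |x| ≤ |s| := by
        have := sq_le_sq_add_sq_of_mem_uIcc hx
        exact sq_le_sq.1 (by simpa using this)
      exact h4.trans (by gcongr)
    rw [sub_zero, Real.norm_eq_abs, Real.norm_eq_abs] at h3
    have h4 : |deriv g s| ≤ |deriv g s - deriv g 0| + |deriv g 0| := by
      simpa using abs_add_le (deriv g s - deriv g 0) (deriv g 0)
    have h5 : |s| ≤ 1 + s ^ 2 := by
      rw [← sq_abs s]
      nlinarith [sq_nonneg (|s| - 1), sq_nonneg |s|]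
    have h6 : C * (1 + |s|) * |s| ≤ 2 * C * (1 + s ^ 2) := by
      have : (1 + |s|) * |s| ≤ 2 * (1 + s ^ 2) := by
        rw [← sq_abs s] at h5 ⊢
        nlinarith
      nlinarith
    nlinarith [mul_nonneg hM (sq_nonneg s)]
  have h3 := (convex_uIcc v u).norm_image_sub_le_of_norm_deriv_le (f := g)
    (C := (M + 2 * C) * (1 + u ^ 2 + v ^ 2)) (fun x _ => hd x) (fun x hx => ?_)
    left_mem_uIcc right_mem_uIcc
  · exact h3
  · refine (h1 x).trans ?_
    have := sq_le_sq_add_sq_of_mem_uIcc hx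
    exact mul_le_mul_of_nonneg_left (by linarith) (by positivity)

theorem abs_integral_sub_le {g : ℝ → ℝ} (hg : Continuous g) {K : ℝ} (hK : 0 ≤ K)
    (hlip : ∀ u v, |g u - g v| ≤ K * (1 + u ^ 2 + v ^ 2) * |u - v|) (u v : ℝ) :
    |(∫ s in (0 : ℝ)..v, g s) - (∫ s in (0 : ℝ)..u, g s) - g u * (v - u)|
      ≤ 2 * K * |v - u| * |(1 + u ^ 2 + v ^ 2) * (v - u)| := by
  have hi : ∀ a b, IntervalIntegrable g volume a b := fun a b => hg.intervalIntegrable _ _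
  have e : (∫ s in (0 : ℝ)..v, g s) - (∫ s in (0 : ℝ)..u, g s) - g u * (v - u)
      = ∫ s in u..v, (g s - g u) := by
    rw [intervalIntegral.integral_interval_sub_left (hi _ _) (hi _ _),
      intervalIntegral.integral_sub (hi _ _) (by simp), intervalIntegral.integral_const,
      smul_eq_mul, mul_comm]
  have h1 : ‖∫ s in u..v, (g s - g u)‖ ≤ (2 * K * (1 + u ^ 2 + v ^ 2) * |v - u|) * |v - u| := by
    refine intervalIntegral.norm_integral_le_of_norm_le_const fun s hs => ?_
    have hs' := uIoc_subset_uIcc hs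
    have h2 := sq_le_sq_add_sq_of_mem_uIcc hs'
    have h3 : |s - u| ≤ |v - u| := abs_sub_left_of_mem_uIcc hs'
    calc ‖g s - g u‖ ≤ K * (1 + s ^ 2 + u ^ 2) * |s - u| := hlip s u
      _ ≤ K * (2 * (1 + u ^ 2 + v ^ 2)) * |v - u| := by
        gcongr
        nlinarith [sq_nonneg v]
      _ = _ := by ring
  rw [e, abs_mul, abs_of_nonneg (by positivity : 0 ≤ 1 + u ^ 2 + v ^ 2)]
  rw [Real.norm_eq_abs] at h1
  linarith

end PointwiseBounds

section L2Bounds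

variable {Ω : Opens E3}

theorem integrable_abs_mul (p q : L2 Ω) : Integrable (fun x => |p x| * |q x|) (vol Ω) :=
  (Lp.memLp p).norm.integrable_mul (Lp.memLp q).norm

theorem integral_abs_mul_le (p q : L2 Ω) : ∫ x, |p x| * |q x| ∂vol Ω ≤ ‖p‖ * ‖q‖ := by
  have h1 : ∫ x, |p x| * |q x| ∂vol Ω = inner ℝ |p| |q| := by
    rw [L2.inner_def]
    refine integral_congr_ae ?_
    filter_upwards [Lp.coeFn_abs p, Lp.coeFn_abs q] with x h1 h2
    rw [h1, h2, mul_comm]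
    rfl
  rw [h1]
  exact (real_inner_le_norm _ _).trans (by rw [norm_abs_eq_norm, norm_abs_eq_norm])

/-- The products `(1 + u² + v²) ζ` as elements of `L²(Ω)`. -/
theorem exists_weighted (Ω : Opens E3) :
    ∃ C : ℝ, 0 ≤ C ∧ ∀ u v ζ : H10 Ω, ∃ W : L2 Ω,
      (∀ᵐ x ∂vol Ω, W x = (1 + toL2 Ω u x ^ 2 + toL2 Ω v x ^ 2) * toL2 Ω ζ x) ∧
      ‖W‖ ≤ C * (1 + ‖u‖ ^ 2 + ‖v‖ ^ 2) * ‖ζ‖ := by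
  obtain ⟨C, hC, h⟩ := exists_weight_bound Ω
  refine ⟨C, hC, fun u v ζ => ⟨(h u v ζ).1.toLp, (h u v ζ).1.coeFn_toLp, ?_⟩⟩
  rw [Lp.norm_toLp]
  exact ENNReal.toReal_le_of_le_ofReal (by positivity) (h u v ζ).2

theorem toL2_sub_ae (u v : H10 Ω) :
    ∀ᵐ x ∂vol Ω, toL2 Ω (u - v) x = toL2 Ω u x - toL2 Ω v x := by
  rw [map_sub]
  exact Lp.coeFn_sub _ _

end L2Bounds

namespace NonlinearAssumption

variable {Ω : Opens E3} {f : E3 → ℝ → ℝ} {μ : ℝ} {c : E3 → ℝ}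

theorem exists_lipschitz_bound (hf : NonlinearAssumption Ω f μ c) :
    ∃ K : ℝ, 0 ≤ K ∧ ∀ᵐ x ∂vol Ω, ∀ u v,
      |f x u - f x v| ≤ K * (1 + u ^ 2 + v ^ 2) * |u - v| := by
  obtain ⟨C, hC, hgr⟩ := hf.growth
  set M := (eLpNormEssSup (fun x => deriv (f x) 0) (vol Ω)).toReal
  refine ⟨M + 2 * C, by positivity, ?_⟩
  have hfin : eLpNormEssSup (fun x => deriv (f x) 0) (vol Ω) ≠ ∞ := by
    have := hf.deriv_memLinfty.eLpNorm_ne_top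
    rwa [eLpNorm_exponent_top] at this
  filter_upwards [hf.contDiff, hgr,
    ae_le_eLpNormEssSup (f := fun x => deriv (f x) 0) (μ := vol Ω)] with x h1 h2 h3
  refine abs_sub_le_of_abs_iteratedDeriv_two_le h1 hC ?_ h2
  have := (ENNReal.toReal_le_toReal (by simp) hfin).2 h3
  simpa using this

/-- A jointly measurable function that agrees with `f` for almost every `x`. -/
theorem exists_measurable_modification (hf : NonlinearAssumption Ω f μ c) :
    ∃ g : E3 → ℝ → ℝ, Measurable (Function.uncurry g) ∧ ∀ᵐ x ∂vol Ω, g x = f x := by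
  classical
  have hae : ∀ᵐ x ∂vol Ω, Continuous (f x) ∧ ∀ q : ℚ, f x q = (hf.meas q).mk _ x := by
    have h1 : ∀ᵐ x ∂vol Ω, ∀ q : ℚ, f x q = (hf.meas q).mk _ x :=
      ae_all_iff.2 fun q => (hf.meas q).ae_eq_mk
    filter_upwards [hf.contDiff, h1] with x h1 h2 using ⟨h1.continuous, h2⟩
  set N := toMeasurable (vol Ω) {x | ¬ (Continuous (f x) ∧ ∀ q : ℚ, f x q = (hf.meas q).mk _ x)}
  have hN : MeasurableSet N := measurableSet_toMeasurable _ _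
  have hgood : ∀ x ∉ N, Continuous (f x) ∧ ∀ q : ℚ, f x q = (hf.meas q).mk _ x := fun x hx => by
    by_contra h
    exact hx (subset_toMeasurable _ _ h)
  set g : E3 → ℝ → ℝ := fun x u => if x ∈ N then 0 else f x u with hg
  have hgc : ∀ x, Continuous (g x) := fun x => by
    by_cases hx : x ∈ N
    · simpa [hg, hx] using continuous_const
    · simpa [hg, hx] using (hgood x hx).1
  have hgq : ∀ q : ℚ, Measurable fun x => g x q := fun q => by
    have : (fun x => g x q) = fun x => if x ∈ N then 0 else (hf.meas q).mk _ x := by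
      funext x
      by_cases hx : x ∈ N
      · simp [hg, hx]
      · simp [hg, hx, (hgood x hx).2 q]
    rw [this]
    exact Measurable.ite hN measurable_const (hf.meas q).measurable_mk
  have hgm : ∀ u : ℝ, Measurable fun x => g x u := fun u => by
    obtain ⟨q, hq⟩ := mem_closure_iff_seq_limit.1 (Rat.denseRange_cast (𝕜 := ℝ) u)
    choose p hp using hq.1
    refine measurable_of_tendsto_metrizable (fun n => hgq (p n)) (tendsto_pi_nhds.2 fun x => ?_)
    simp only [hp]
    exact ((hgc x).tendsto u).comp hq.2
  refine ⟨g, ?_, ?_⟩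
  · have := measurable_uncurry_of_continuous_of_measurable (u := fun (u : ℝ) (x : E3) => g x u)
      hgc hgm
    exact this.comp measurable_swap
  · have hN0 : ∀ᵐ x ∂vol Ω, x ∉ N :=
      measure_eq_zero_iff_ae_notMem.1 ((measure_toMeasurable _).trans (ae_iff.1 hae))
    filter_upwards [hN0] with x hx
    funext u
    simp [hg, hx]

theorem aestronglyMeasurable_comp (hf : NonlinearAssumption Ω f μ c) (u : L2 Ω) :
    AEStronglyMeasurable (fun x => f x (u x)) (vol Ω) := by
  obtain ⟨g, hg, hgf⟩ := hf.exists_measurable_modification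
  have h1 : Measurable fun x => g x (u x) :=
    hg.comp (measurable_id.prodMk (Lp.stronglyMeasurable u).measurable)
  refine h1.aestronglyMeasurable.congr ?_
  filter_upwards [hgf] with x hx
  rw [hx]

theorem primitive_ae_eq (hf : NonlinearAssumption Ω f μ c) :
    ∀ᵐ x ∂vol Ω, ∀ u, primitive f x u = ∫ s in (0 : ℝ)..u, f x s := by
  filter_upwards [hf.contDiff] with x hx u
  rw [primitive, if_pos hx.continuous]

theorem aestronglyMeasurable_primitive_comp (hf : NonlinearAssumption Ω f μ c) (u : L2 Ω) :
    AEStronglyMeasurable (fun x => primitive f x (u x)) (vol Ω) := by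
  obtain ⟨g, hg, hgf⟩ := hf.exists_measurable_modification
  have hu : Measurable (u : E3 → ℝ) := (Lp.stronglyMeasurable u).measurable
  have h1 : Measurable fun p : E3 × ℝ => g p.1 (u p.1 * p.2) :=
    hg.comp (measurable_fst.prodMk ((hu.comp measurable_fst).mul measurable_snd))
  have h2 : StronglyMeasurable fun x => ∫ θ in Ioc (0 : ℝ) 1, g x (u x * θ) :=
    h1.stronglyMeasurable.integral_prod_right
  refine (hu.stronglyMeasurable.mul h2).aestronglyMeasurable.congr ?_
  filter_upwards [hgf, hf.primitive_ae_eq] with x hx hp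
  rw [hp, ← hx, Pi.mul_apply, ← intervalIntegral.integral_of_le zero_le_one]
  simp

theorem memLp_comp (hf : NonlinearAssumption Ω f μ c) (u : H10 Ω) :
    MemLp (fun x => f x (toL2 Ω u x)) 2 (vol Ω) := by
  obtain ⟨K, hK, hlip⟩ := hf.exists_lipschitz_bound
  obtain ⟨C, -, hC⟩ := exists_weighted Ω
  obtain ⟨W, hW, -⟩ := hC u 0 u
  have h0 : ∀ᵐ x ∂vol Ω, toL2 Ω 0 x = 0 := by
    rw [map_zero]
    exact Lp.coeFn_zero _ _ _
  have h1 : MemLp (fun x => f x (toL2 Ω u x) - f x 0) 2 (vol Ω) := by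
    refine ((Lp.memLp W).const_mul K).mono
      ((hf.aestronglyMeasurable_comp _).sub hf.memL2.1) ?_
    filter_upwards [hlip, hW, h0] with x h1 h2 h0
    have := h1 (toL2 Ω u x) 0
    rw [h2, norm_mul, norm_mul, Real.norm_eq_abs, Real.norm_eq_abs, Real.norm_eq_abs,
      Real.norm_eq_abs, h0, abs_of_nonneg hK, abs_of_nonneg (by positivity : (0:ℝ) ≤ 1 + _ + _),
      ← mul_assoc]
    simpa using this
  exact (h1.add hf.memL2).ae_eq (ae_of_all _ fun x => sub_add_cancel _ _)

theorem coeFn_nemitski (hf : NonlinearAssumption Ω f μ c) (u : H10 Ω) :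
    ∀ᵐ x ∂vol Ω, nemitski f u x = f x (toL2 Ω u x) := by
  rw [nemitski, dif_pos (hf.memLp_comp u)]
  exact (hf.memLp_comp u).coeFn_toLp

theorem exists_norm_nemitski_sub_le (hf : NonlinearAssumption Ω f μ c) :
    ∃ C : ℝ, 0 ≤ C ∧ ∀ u v : H10 Ω,
      ‖nemitski f u - nemitski f v‖ ≤ C * (1 + ‖u‖ ^ 2 + ‖v‖ ^ 2) * ‖u - v‖ := by
  obtain ⟨K, hK, hlip⟩ := hf.exists_lipschitz_bound
  obtain ⟨C, hC, hw⟩ := exists_weighted Ω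
  refine ⟨K * C, by positivity, fun u v => ?_⟩
  obtain ⟨W, hW, hWn⟩ := hw u v (u - v)
  have h1 : ‖nemitski f u - nemitski f v‖ ≤ K * ‖W‖ := by
    refine Lp.norm_le_mul_norm_of_ae_le_mul ?_
    filter_upwards [hlip, hW, toL2_sub_ae u v, Lp.coeFn_sub (nemitski f u) (nemitski f v),
      hf.coeFn_nemitski u, hf.coeFn_nemitski v] with x h1 h2 h3 h4 h5 h6
    rw [h4, Pi.sub_apply, h5, h6, h2, h3, Real.norm_eq_abs, norm_mul, Real.norm_eq_abs,
      Real.norm_eq_abs, abs_of_nonneg (by positivity : (0:ℝ) ≤ 1 + _ + _), ← mul_assoc]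
    exact h1 _ _
  calc _ ≤ K * ‖W‖ := h1
    _ ≤ K * (C * (1 + ‖u‖ ^ 2 + ‖v‖ ^ 2) * ‖u - v‖) := by gcongr
    _ = _ := by ring

theorem continuous_nemitski (hf : NonlinearAssumption Ω f μ c) :
    Continuous (nemitski f : H10 Ω → L2 Ω) := by
  obtain ⟨C, -, hC⟩ := hf.exists_norm_nemitski_sub_le
  rw [continuous_iff_continuousAt]
  intro v
  rw [ContinuousAt, tendsto_iff_norm_sub_tendsto_zero]
  refine squeeze_zero (fun _ => norm_nonneg _) (fun u => hC u v) ?_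
  have : Continuous fun u : H10 Ω => C * (1 + ‖u‖ ^ 2 + ‖v‖ ^ 2) * ‖u - v‖ := by fun_prop
  simpa using this.tendsto v

/-- The Nemitski operator is locally Lipschitz from `H¹₀(Ω)` with the norm of `L²(Ω)` to the dual
space: the growth of `∂ᵤf` is absorbed by the test function. -/
theorem exists_inner_nemitski_sub_le (hf : NonlinearAssumption Ω f μ c) :
    ∃ C : ℝ, 0 ≤ C ∧ ∀ u v ζ : H10 Ω,
      |inner ℝ (nemitski f u - nemitski f v) (toL2 Ω ζ)|
        ≤ C * (1 + ‖u‖ ^ 2 + ‖v‖ ^ 2) * ‖toL2 Ω (u - v)‖ * ‖ζ‖ := by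
  obtain ⟨K, hK, hlip⟩ := hf.exists_lipschitz_bound
  obtain ⟨C, hC, hw⟩ := exists_weighted Ω
  refine ⟨K * C, by positivity, fun u v ζ => ?_⟩
  obtain ⟨W, hW, hWn⟩ := hw u v ζ
  have h1 : |inner ℝ (nemitski f u - nemitski f v) (toL2 Ω ζ)|
      ≤ ∫ x, K * (|toL2 Ω (u - v) x| * |W x|) ∂vol Ω := by
    rw [L2.inner_def, ← Real.norm_eq_abs]
    refine norm_integral_le_of_norm_le ((integrable_abs_mul _ _).const_mul K) ?_
    filter_upwards [hlip, hW, toL2_sub_ae u v, Lp.coeFn_sub (nemitski f u) (nemitski f v),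
      hf.coeFn_nemitski u, hf.coeFn_nemitski v] with x h1 h2 h3 h4 h5 h6
    refine (norm_inner_le_norm _ _).trans ?_
    rw [h4, Pi.sub_apply, h5, h6, h2, h3, abs_mul,
      abs_of_nonneg (by positivity : (0:ℝ) ≤ 1 + _ + _), Real.norm_eq_abs, Real.norm_eq_abs]
    calc _ ≤ (K * (1 + toL2 Ω u x ^ 2 + toL2 Ω v x ^ 2) * |toL2 Ω u x - toL2 Ω v x|)
          * |toL2 Ω ζ x| := by
          gcongr
          exact h1 _ _
      _ = _ := by ring
  rw [integral_const_mul] at h1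
  calc _ ≤ K * ∫ x, |toL2 Ω (u - v) x| * |W x| ∂vol Ω := h1
    _ ≤ K * (‖toL2 Ω (u - v)‖ * (C * (1 + ‖u‖ ^ 2 + ‖v‖ ^ 2) * ‖ζ‖)) := by
      gcongr
      exact (integral_abs_mul_le _ _).trans (by gcongr)
    _ = _ := by ring

end NonlinearAssumption

/-- The potential `u ↦ ∫ F(x, u(x)) dx` of the Nemitski operator. -/
def potential {Ω : Opens E3} (f : E3 → ℝ → ℝ) (u : H10 Ω) : ℝ :=
  ∫ x, primitive f x (toL2 Ω u x) ∂vol Ω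

namespace NonlinearAssumption

variable {Ω : Opens E3} {f : E3 → ℝ → ℝ} {μ : ℝ} {c : E3 → ℝ}

theorem potential_zero (hf : NonlinearAssumption Ω f μ c) : potential f (0 : H10 Ω) = 0 := by
  refine integral_eq_zero_of_ae ?_
  have h0 : ∀ᵐ x ∂vol Ω, toL2 Ω 0 x = 0 := by
    rw [map_zero]
    exact Lp.coeFn_zero _ _ _
  filter_upwards [hf.primitive_ae_eq, h0] with x h1 h2
  rw [h1, h2, intervalIntegral.integral_same, Pi.zero_apply]

/-- The remainder in the first order expansion of the potential. One of its two factors is an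
`L²`-norm, so that the potential is differentiable along curves that are continuous in `H¹₀(Ω)` and
differentiable in `L²(Ω)` only. -/
theorem exists_potential_remainder_le (hf : NonlinearAssumption Ω f μ c) :
    ∃ C : ℝ, 0 ≤ C ∧ ∀ u v : H10 Ω,
      |potential f v - potential f u - inner ℝ (nemitski f u) (toL2 Ω (v - u))|
        ≤ C * (1 + ‖u‖ ^ 2 + ‖v‖ ^ 2) * ‖v - u‖ * ‖toL2 Ω (v - u)‖ := by
  obtain ⟨K, hK, hlip⟩ := hf.exists_lipschitz_bound
  obtain ⟨C, hC, hw⟩ := exists_weighted Ω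
  have hrem : ∀ u v : H10 Ω, ∀ W : L2 Ω,
      (∀ᵐ x ∂vol Ω, W x = (1 + toL2 Ω u x ^ 2 + toL2 Ω v x ^ 2) * toL2 Ω (v - u) x) →
      ∀ᵐ x ∂vol Ω, ‖primitive f x (toL2 Ω v x) - primitive f x (toL2 Ω u x)
        - inner ℝ (nemitski f u x) (toL2 Ω (v - u) x)‖
        ≤ 2 * K * (|toL2 Ω (v - u) x| * |W x|) := by
    intro u v W hW
    filter_upwards [hlip, hf.contDiff, hf.primitive_ae_eq, hf.coeFn_nemitski u, toL2_sub_ae v u, hW]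
      with x h1 h2 h3 h4 h5 h6
    have := abs_integral_sub_le h2.continuous hK h1 (toL2 Ω u x) (toL2 Ω v x)
    rwa [h3, h3, h4, h6, h5, Real.norm_eq_abs, RCLike.inner_apply, conj_trivial, mul_comm (_ - _),
      ← mul_assoc]
  have hinner : ∀ u v : H10 Ω, Integrable
      (fun x => inner ℝ (nemitski f u x) (toL2 Ω (v - u) x)) (vol Ω) := fun u v =>
    L2.integrable_inner _ _
  have hmeas : ∀ u : H10 Ω, AEStronglyMeasurable
      (fun x => primitive f x (toL2 Ω u x)) (vol Ω) := fun u =>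
    hf.aestronglyMeasurable_primitive_comp _
  -- `F(x, 0) = 0`, so the remainder estimate at `u = 0` shows that the potential is finite
  have hint : ∀ v : H10 Ω, Integrable (fun x => primitive f x (toL2 Ω v x)) (vol Ω) := by
    intro v
    obtain ⟨W, hW, -⟩ := hw 0 v (v - 0)
    have h0 : ∀ᵐ x ∂vol Ω, toL2 Ω 0 x = 0 := by
      rw [map_zero]
      exact Lp.coeFn_zero _ _ _
    have h1 : Integrable (fun x => primitive f x (toL2 Ω v x) - primitive f x (toL2 Ω 0 x)
        - inner ℝ (nemitski f 0 x) (toL2 Ω (v - 0) x)) (vol Ω) :=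
      ((integrable_abs_mul (toL2 Ω (v - 0)) W).const_mul (2 * K)).mono'
        (((hmeas v).sub (hmeas 0)).sub (hinner 0 v).1) (hrem 0 v W hW)
    refine (h1.add (hinner 0 v)).congr ?_
    filter_upwards [hf.primitive_ae_eq, h0] with x h2 h3
    rw [Pi.add_apply, sub_add_cancel, h3, h2 0, intervalIntegral.integral_same, sub_zero]
  refine ⟨2 * K * C, by positivity, fun u v => ?_⟩
  obtain ⟨W, hW, hWn⟩ := hw u v (v - u)
  have h1 : |potential f v - potential f u - inner ℝ (nemitski f u) (toL2 Ω (v - u))|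
      ≤ ∫ x, 2 * K * (|toL2 Ω (v - u) x| * |W x|) ∂vol Ω := by
    have hd : Integrable
        (fun x => primitive f x (toL2 Ω v x) - primitive f x (toL2 Ω u x)) (vol Ω) :=
      (hint v).sub (hint u)
    rw [potential, potential, L2.inner_def, ← integral_sub (hint v) (hint u),
      ← integral_sub hd (hinner u v), ← Real.norm_eq_abs]
    exact norm_integral_le_of_norm_le ((integrable_abs_mul _ _).const_mul _) (hrem u v W hW)
  rw [integral_const_mul] at h1
  calc _ ≤ 2 * K * ∫ x, |toL2 Ω (v - u) x| * |W x| ∂vol Ω := h1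
    _ ≤ 2 * K * (‖toL2 Ω (v - u)‖ * (C * (1 + ‖u‖ ^ 2 + ‖v‖ ^ 2) * ‖v - u‖)) := by
      gcongr
      exact (integral_abs_mul_le _ _).trans (by gcongr)
    _ = _ := by ring

theorem hasDerivAt_potential (hf : NonlinearAssumption Ω f μ c) {u : ℝ → H10 Ω} {v : L2 Ω} {t : ℝ}
    (hu : ContinuousAt u t) (hv : HasDerivAt (fun s => toL2 Ω (u s)) v t) :
    HasDerivAt (fun s => potential f (u s)) (inner ℝ (nemitski f (u t)) v) t := by
  obtain ⟨C, -, hC⟩ := hf.exists_potential_remainder_le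
  have h1 : HasDerivAt (fun s => inner ℝ (nemitski f (u t)) (toL2 Ω (u s)))
      (inner ℝ (nemitski f (u t)) v) t := by
    simpa using (hasDerivAt_const t (nemitski f (u t))).inner ℝ hv
  have h2 : HasDerivAt (fun s => potential f (u s)
      - inner ℝ (nemitski f (u t)) (toL2 Ω (u s))) 0 t := by
    rw [hasDerivAt_iff_isLittleO]
    have h3 : (fun s => C * (1 + ‖u t‖ ^ 2 + ‖u s‖ ^ 2) * ‖u s - u t‖) =o[𝓝 t]
        fun _ => (1 : ℝ) := by
      rw [Asymptotics.isLittleO_one_iff]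
      have : ContinuousAt (fun s => C * (1 + ‖u t‖ ^ 2 + ‖u s‖ ^ 2) * ‖u s - u t‖) t := by
        fun_prop
      simpa [ContinuousAt] using this
    have h4 : (fun s => ‖toL2 Ω (u s - u t)‖) =O[𝓝 t] fun s => s - t := by
      simpa only [map_sub] using hv.isBigO_sub.norm_left
    have h5 := h3.mul_isBigO h4
    simp only [one_mul] at h5
    refine Asymptotics.IsBigO.trans_isLittleO (Asymptotics.IsBigO.of_bound 1 ?_) h5
    refine Eventually.of_forall fun s => ?_
    have h6 := hC (u t) (u s)
    rw [smul_zero, sub_zero, one_mul]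
    refine le_trans (le_of_eq ?_) (h6.trans (le_abs_self _))
    rw [map_sub, inner_sub_right, Real.norm_eq_abs]
    congr 1
    ring
  simpa [Pi.add_def] using h2.add h1

theorem exists_potential_bound (hf : NonlinearAssumption Ω f μ c) (R : ℝ) :
    ∃ P : ℝ, ∀ u : H10 Ω, ‖u‖ ≤ R → |potential f u| ≤ P := by
  obtain ⟨C, hC, h⟩ := hf.exists_potential_remainder_le
  refine ⟨‖nemitski f (0 : H10 Ω)‖ * R + C * (1 + R ^ 2) * R * R, fun u hu => ?_⟩
  have hR : 0 ≤ R := (norm_nonneg _).trans hu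
  have hu' := (norm_toL2_le u).trans hu
  have h1 := h 0 u
  rw [hf.potential_zero, sub_zero, sub_zero, norm_zero] at h1
  have h2 : |inner ℝ (nemitski f (0 : H10 Ω)) (toL2 Ω u)| ≤ ‖nemitski f (0 : H10 Ω)‖ * R :=
    (abs_real_inner_le_norm _ _).trans (by gcongr)
  have h3 : C * (1 + 0 ^ 2 + ‖u‖ ^ 2) * ‖u‖ * ‖toL2 Ω u‖ ≤ C * (1 + R ^ 2) * R * R := by
    rw [zero_pow two_ne_zero, add_zero]
    gcongr
  have h4 := abs_add_le (potential f u - inner ℝ (nemitski f (0 : H10 Ω)) (toL2 Ω u))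
    (inner ℝ (nemitski f (0 : H10 Ω)) (toL2 Ω u))
  rw [sub_add_cancel] at h4
  linarith

theorem exists_nemitski_bound (hf : NonlinearAssumption Ω f μ c) (R : ℝ) :
    ∃ P : ℝ, ∀ u : H10 Ω, ‖u‖ ≤ R → ‖nemitski f u‖ ≤ P := by
  obtain ⟨C, hC, h⟩ := hf.exists_norm_nemitski_sub_le
  refine ⟨C * (1 + R ^ 2) * R + ‖nemitski f (0 : H10 Ω)‖, fun u hu => ?_⟩
  have hR : 0 ≤ R := (norm_nonneg _).trans hu
  have h1 := h u 0
  rw [sub_zero, norm_zero, zero_pow two_ne_zero, add_zero] at h1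
  have h2 : C * (1 + ‖u‖ ^ 2) * ‖u‖ ≤ C * (1 + R ^ 2) * R := by gcongr
  linarith [norm_le_norm_sub_add (nemitski f u) (nemitski f (0 : H10 Ω))]

end NonlinearAssumption

/-! ### Full solutions of the damped wave equation -/

section Main

variable {Ω : Opens E3} {a₀ a₁ : ℝ} {a : Fin 3 → Fin 3 → E3 → ℝ} {β : E3 → ℝ}
  {f : E3 → ℝ → ℝ} {μ : ℝ} {c : E3 → ℝ} {ε : ℝ} {z : ℝ → Phase Ω}

/-- A full solution of the semiflow solves the equation in `L²(Ω) × H_{-1}`. -/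
theorem IsFullSolution.isWeakSolution (hz : IsFullSolution a β f ε z)
    (hlin : LinearAssumption Ω a₀ a₁ a β) (hf : NonlinearAssumption Ω f μ c) :
    IsWeakSolution (toL2 Ω) hlin.form ε (fun t => (z t).1) (fun t => (z t).2)
      (fun t => nemitski f (z t).1) := by
  obtain ⟨T, ⟨hT, hgen⟩, hzc, hmild⟩ := hz
  have huc : Continuous fun t => (z t).1 := by fun_prop
  have hvc : Continuous fun t => (z t).2 := by fun_prop
  have hnc : Continuous fun t => nemitski f (z t).1 := hf.continuous_nemitski.comp huc
  have hgc : Continuous fun t => ((0 : H10 Ω), (1 / ε) • nemitski f (z t).1) := by fun_prop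
  have hfst : ∀ {y : ℝ → Phase Ω}, Continuous y → ∀ s t,
      (∫ τ in s..t, y τ).1 = ∫ τ in s..t, (y τ).1 := fun {y} hy s t =>
    ((ContinuousLinearMap.fst ℝ (H10 Ω) (L2 Ω)).intervalIntegral_comp_comm
      (hy.intervalIntegrable (μ := volume) s t)).symm
  have hsnd : ∀ {y : ℝ → Phase Ω}, Continuous y → ∀ s t,
      (∫ τ in s..t, y τ).2 = ∫ τ in s..t, (y τ).2 := fun {y} hy s t =>
    ((ContinuousLinearMap.snd ℝ (H10 Ω) (L2 Ω)).intervalIntegral_comp_comm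
      (hy.intervalIntegrable (μ := volume) s t)).symm
  have key : ∀ s t, (toL2 Ω (z t).1 - toL2 Ω (z s).1 = ∫ τ in s..t, (z τ).2) ∧
      ∃ h, hlin.form (∫ τ in s..t, (z τ).1) = dualIncl (toL2 Ω) h ∧ (z t).2 - (z s).2
        = ε⁻¹ • ((∫ τ in s..t, nemitski f (z τ).1) - (∫ τ in s..t, (z τ).2) - h) := by
    intro s t
    have hlim := hT.tendsto_of_mild hzc hgc hmild s t
    rw [← neg_neg (z t - z s - _)] at hlim
    obtain ⟨v, h, hv, hh, hy⟩ := (hgen _ _).1 hlim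
    have hh' := hlin.form_eq_of_isEllipticOp hh
    rw [hfst hzc] at hh'
    rw [hsnd hzc] at hv hy
    have hy1 := congrArg Prod.fst hy
    have hy2 := congrArg Prod.snd hy
    simp only [Prod.fst_neg, Prod.snd_neg, Prod.fst_sub, Prod.snd_sub, hfst hgc, hsnd hgc,
      intervalIntegral.integral_zero, intervalIntegral.integral_smul, sub_zero, neg_inj] at hy1 hy2
    refine ⟨by rw [← map_sub, hy1, hv], h, hh', ?_⟩
    rw [← sub_eq_zero] at hy2 ⊢
    rw [← neg_eq_zero, ← hy2]
    simp only [one_div, smul_sub]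
    abel
  exact IsWeakSolution.of_integral huc hvc hnc (fun s t => (key s t).1) fun s t => (key s t).2

/-- The energy identity of the semiflow bounds the dissipation integral by bounds on the energy. -/
theorem IsFullSolution.integral_norm_sq_le (hz : IsFullSolution a β f ε z)
    (hlin : LinearAssumption Ω a₀ a₁ a β) (hf : NonlinearAssumption Ω f μ c) (hε : 0 < ε) {r P : ℝ}
    (hr : ∀ t, h1Inner a β (z t).1 (z t).1 + ε * ‖(z t).2‖ ^ 2 ≤ r)
    (hP : ∀ t, |potential f (z t).1| ≤ P) (s t : ℝ) :
    ∫ τ in s..t, ‖(z τ).2‖ ^ 2 ≤ r / 2 + 2 * P := by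
  have hw := hz.isWeakSolution hlin hf
  have huc := hw.continuous_u
  have hvc := hw.continuous_v
  have hnc := hw.continuous_g
  have h1 := hw.energy_identity hε.ne' (fun x y => hlin.h1Inner_comm x y) s t
  have h2 : ∫ τ in s..t, inner ℝ (nemitski f (z τ).1) (z τ).2
      = potential f (z t).1 - potential f (z s).1 :=
    intervalIntegral.integral_eq_sub_of_hasDerivAt
      (fun τ _ => hf.hasDerivAt_potential huc.continuousAt (hw.hasDerivAt_u τ))
      (Continuous.intervalIntegrable (by fun_prop) _ _)
  rw [intervalIntegral.integral_sub (Continuous.intervalIntegrable (by fun_prop) _ _)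
    (Continuous.intervalIntegrable (by fun_prop) _ _), h2, hlin.form_apply, hlin.form_apply] at h1
  have h3 := hlin.h1Inner_self_nonneg (z t).1
  have h4 : 0 ≤ ε * ‖(z t).2‖ ^ 2 := by positivity
  have h5 := hr s
  have h6 := abs_le.1 (hP s)
  have h7 := abs_le.1 (hP t)
  linarith [h6.1, h7.2]

end Main

end DampedWave

end

theorem proposition3p6 (Ω : TopologicalSpace.Opens DampedWave.E3)
    (a₀ a₁ : ℝ) (a : Fin 3 → Fin 3 → DampedWave.E3 → ℝ) (β : DampedWave.E3 → ℝ)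
    (hlin : DampedWave.LinearAssumption Ω a₀ a₁ a β)
    (f : DampedWave.E3 → ℝ → ℝ) (μ : ℝ) (c : DampedWave.E3 → ℝ)
    (hf : DampedWave.NonlinearAssumption Ω f μ c)
    (ε₀ : ℝ) (hε₀ : 0 < ε₀) (r : ℝ) (hr : 0 ≤ r) :
    ∃ C : ℝ, 0 ≤ C ∧ ∀ ε : ℝ, 0 < ε → ε ≤ ε₀ →
      ∀ z : ℝ → DampedWave.Phase Ω, DampedWave.IsFullSolution a β f ε z →
        (∀ t : ℝ, DampedWave.h1Inner a β (z t).1 (z t).1 + ε * ‖(z t).2‖ ^ 2 ≤ r) →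
        ∃ w : ℝ → DampedWave.HNeg Ω,
          (∀ t : ℝ, HasDerivAt (fun s => DampedWave.toHNeg Ω (z s).2) (w t) t) ∧
          ∀ t : ℝ, ‖(z t).2‖ ^ 2 + ε * DampedWave.hNegNorm a β (w t) ^ 2 ≤ C := by
  obtain ⟨κ, hκ, hco⟩ := hlin.exists_coercivity
  obtain ⟨S, hS⟩ := hlin.exists_form_inverse
  set R := √(r / κ)
  obtain ⟨P, hP⟩ := hf.exists_potential_bound (Ω := Ω) R
  obtain ⟨G, hG⟩ := hf.exists_nemitski_bound (Ω := Ω) R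
  obtain ⟨L, hL, hLip⟩ := hf.exists_inner_nemitski_sub_le (Ω := Ω)
  have hP0 : 0 ≤ P := (abs_nonneg _).trans (hP 0 (by simp [R]))
  obtain ⟨C, hC, hbound⟩ := DampedWave.IsWeakSolution.exists_derivative_energy_bound
    (j := DampedWave.toL2 Ω) (fun x y => hlin.h1Inner_comm x y) hlin.h1Inner_self_nonneg hS
    (L := L * (1 + R ^ 2 + R ^ 2)) (D := r / 2 + 2 * P) (by positivity) (by positivity)
  refine ⟨C, hC, fun ε hε _ z hz hzr => ?_⟩
  have hw := hz.isWeakSolution hlin hf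
  have hR : ∀ t, ‖(z t).1‖ ≤ R := fun t => by
    apply Real.le_sqrt_of_sq_le
    rw [le_div_iff₀ hκ]
    have h1 := hco (z t).1
    have h2 : 0 ≤ ε * ‖(z t).2‖ ^ 2 := by positivity
    linarith [hzr t]
  have hV : ∀ t, ‖(z t).2‖ ≤ √(r / ε) := fun t => by
    apply Real.le_sqrt_of_sq_le
    rw [le_div_iff₀ hε]
    linarith [hzr t, hlin.h1Inner_self_nonneg (z t).1]
  have hD := hz.integral_norm_sq_le hlin hf hε hzr fun t => hP _ (hR t)
  refine ⟨_, hw.hasDerivAt_v, fun t => le_trans ?_ (hbound hε hw (fun s t ζ => ?_)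
    (fun s t _ => hD s t) hR hV (fun t => hG _ (hR t)) t)⟩
  · gcongr
    exact hlin.hNegNorm_sq_le hS _
  · refine (hLip _ _ ζ).trans ?_
    have h1 := hR s
    have h2 := hR t
    gcongr
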